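/- **Conventions.** A *Gr-category* is a monoidal category $(\mathbb G,\otimes,I,\mathbf a,\mathbf l,\mathbf r)$, with $\mathbf a_{X,Y,Z}:X\otimes(Y\otimes Z)\to(X\otimes Y)\otimes Z$, in which every morphism is an isomorphism and every object is invertible for $\otimes$. A *Gr-functor* is a (strong) monoidal functor $(F,\widetilde F,F_*)$ between Gr-categories; $\mathcal{CG}$ is the category of Gr-categories and Gr-functors. Two Gr-functors are *homotopic* if there is a monoidal natural isomorphism between them. For a Gr-category $\mathbb G$, $\pi_0\mathbb G$ is the group of isomorphism classes of objects under $\otimes$, and $\pi_1\mathbb G=\mathrm{Aut}(I)$, written additively, is a $\pi_0\mathbb G$-module by $su=\gamma_X^{-1}\delta_X(u)$ for $X\in s$, where $\gamma_X(u)=\mathbf l_X(u\otimes \mathrm{id}_X)\mathbf l_X^{-1}$ and $\delta_X(u)=\mathbf r_X(\mathrm{id}_X\otimes u)\mathbf r_X^{-1}$. Choose representatives $X_s\in s$ $(s\in\pi_0\mathbb G)$ and isomorphisms $\theta_{s,t}:X_s\otimes X_t\to X_{st}$, and define $h:(\pi_0\mathbb G)^3\to\pi_1\mathbb G$ by $$\gamma_{X_{str}}(h(s,t,r))=\theta_{st,r}\,(\theta_{s,t}\otimes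 \mathrm{id})\,\mathbf a_{X_s,X_t,X_r}\,(\mathrm{id}\otimes\theta_{t,r})^{-1}\,\theta_{s,tr}^{-1}.$$ A Gr-functor $F:\mathbb G\to\mathbb G'$ induces $F_0:\pi_0\mathbb G\to\pi_0\mathbb G'$, $[X]\mapsto[FX]$, and $F_1:\pi_1\mathbb G\to\pi_1\mathbb G'$, $u\mapsto\gamma_{FI}^{-1}(Fu)$. The category $\mathbf H^3_{Gr}$ has as objects the triples $(\Pi,A,[h])$ with $\Pi$ a group, $A$ a $\Pi$-module and $[h]\in H^3(\Pi,A)$. A morphism $(\varphi,f):(\Pi,A,[h])\to(\Pi',A',[h'])$ is a pair of group homomorphisms $\varphi:\Pi\to\Pi'$, $f:A\to A'$ with $f(xa)=\varphi(x)f(a)$ and $[\varphi^*h']=[f_*h]$ in $H^3(\Pi,A')$, where $\Pi$ acts on $A'$ through $\varphi$. Composition is componentwise. **Theorem (Classification Theorem).** For every Gr-category $\mathbb G$, each $h$ as above is a 3-cocycle, and its class $[h_{\mathbb G}]\in H^3(\pi_0\mathbb G,\pi_1\mathbb G)$ does not depend on the choices. There is a functor $$d:\mathcal{CG}\to\mathbf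 H^3_{Gr},\qquad \mathbb G\mapsto(\pi_0\mathbb G,\pi_1\mathbb G,[h_{\mathbb G}]),\qquad F\mapsto(F_0,F_1),$$ with the following properties. i) For a Gr-functor $F$, $dF$ is an isomorphism if and only if $F$ is an equivalence. This holds both for "equivalence of the underlying categories" and for "monoidal equivalence", i.e. $F$ has an inverse Gr-functor up to homotopy. ii) $d$ is surjective on objects up to isomorphism: every object of $\mathbf H^3_{Gr}$ is isomorphic to $d\mathbb G$ for some Gr-category $\mathbb G$. iii) $d$ is full but not faithful. For every pair of Gr-categories $\mathbb G,\mathbb G'$ and every morphism $(\varphi,f):d\mathbb G\to d\mathbb G'$ in $\mathbf H^3_{Gr}$, there is a bijection $$\mathrm{Hom}_{(\varphi,f)}[\mathbb G,\mathbb G']\;\cong\;H^2(\pi_0\mathbb G,\pi_1\mathbb G'),$$ where the left side is the set of homotopy classes of Gr-functors $F:\mathbb G\to\mathbb G'$ with $dF=(\varphi,f)$, and $\pi_0\mathbb G$ acts on $\pi_1\mathbb G'$ through $\varphi$. -/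

import Mathlib

open CategoryTheory MonoidalCategory

universe v u

/-! ### Cohomology of a group with coefficients in a module, in degrees 2 and 3

A module over a group `G` is an abelian group `A` with an action `ρ : G →* AddMonoid.End A`. The
cohomology groups are those of the complex of inhomogeneous cochains `G × ⋯ × G → A`. -/

namespace GrpCohomology

section Cochains

variable {G : Type*} {A : Type*} [Group G] [AddCommGroup A] (ρ : G →* AddMonoid.End A)

/-- `(∂t)(x, y) = x • t y - t (x y) + t x`. -/
def d1 : (G → A) →+ (G → G → A) where
  toFun t x y := ρ x (t y) - t (x * y) + t x
  map_zero' := by funext x y; simp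
  map_add' t t' := by funext x y; simp; abel

/-- `(∂g)(x, y, z) = x • g (y, z) - g (x y, z) + g (x, y z) - g (x, y)`. -/
def d2 : (G → G → A) →+ (G → G → G → A) where
  toFun g x y z := ρ x (g y z) - g (x * y) z + g x (y * z) - g x y
  map_zero' := by funext x y z; simp
  map_add' g g' := by funext x y z; simp; abel

/-- `(∂h)(x, y, z, t) = x • h (y, z, t) - h (x y, z, t) + h (x, y z, t) - h (x, y, z t)
+ h (x, y, z)`. -/
def d3 : (G → G → G → A) →+ (G → G → G → G → A) where
  toFun h x y z t :=
    ρ x (h y z t) - h (x * y) z t + h x (y * z) t - h x y (z * t) + h x y z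
  map_zero' := by funext x y z t; simp
  map_add' h h' := by funext x y z t; simp; abel

/-- The group of 2-cocycles. -/
def Z2 : AddSubgroup (G → G → A) := (d2 ρ).ker

/-- The group of 3-cocycles. -/
def Z3 : AddSubgroup (G → G → G → A) := (d3 ρ).ker

/-- The second cohomology group: 2-cocycles modulo coboundaries of functions `G → A`. -/
abbrev H2 := Z2 ρ ⧸ (d1 ρ).range.addSubgroupOf (Z2 ρ)

/-- The third cohomology group: 3-cocycles modulo coboundaries of functions `G × G → A`. -/
abbrev H3 := Z3 ρ ⧸ (d2 ρ).range.addSubgroupOf (Z3 ρ)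

/-- The class `[h]` of a 3-cocycle `h`. -/
abbrev H3.mk (h : Z3 ρ) : H3 ρ := QuotientAddGroup.mk h

end Cochains

section Functoriality

variable {G G' A A' : Type*} [Group G] [Group G'] [AddCommGroup A] [AddCommGroup A']

/-- For a group homomorphism `φ : G → G'` and a `G'`-module, the map `φ^* : Z³(G', A) → Z³(G, A)`,
`(φ^* h) (x, y, z) = h (φ x, φ y, φ z)`; here `G` acts on `A` through `φ`. -/
def Z3.pullback (φ : G →* G') (ρ : G' →* AddMonoid.End A) : Z3 ρ →+ Z3 (ρ.comp φ) where
  toFun h := ⟨fun x y z => h.1 (φ x) (φ y) (φ z), by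
    funext x y z t
    simpa [d3] using congrFun (congrFun (congrFun (congrFun h.2 (φ x)) (φ y)) (φ z)) (φ t)⟩
  map_zero' := rfl
  map_add' _ _ := rfl

/-- `φ^* : H³(G', A) → H³(G, A)`. -/
def H3.pullback (φ : G →* G') (ρ : G' →* AddMonoid.End A) : H3 ρ →+ H3 (ρ.comp φ) :=
  QuotientAddGroup.map _ _ (Z3.pullback φ ρ) (by
    rintro h ⟨g, hg⟩
    refine ⟨fun x y => g (φ x) (φ y), ?_⟩
    funext x y z
    have := congrFun (congrFun (congrFun hg (φ x)) (φ y)) (φ z)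
    simpa [d2, Z3.pullback] using this)

/-- For a homomorphism `f : A → A'` of `G`-modules, the map `f_* : Z³(G, A) → Z³(G, A')`,
`(f_* h) (x, y, z) = f (h (x, y, z))`. -/
def Z3.pushforward {ρ : G →* AddMonoid.End A} {ρ' : G →* AddMonoid.End A'} (f : A →+ A')
    (hf : ∀ x a, f (ρ x a) = ρ' x (f a)) : Z3 ρ →+ Z3 ρ' where
  toFun h := ⟨fun x y z => f (h.1 x y z), by
    funext x y z t
    have := congrArg f (congrFun (congrFun (congrFun (congrFun h.2 x) y) z) t)
    simpa [d3, hf] using this⟩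
  map_zero' := by ext; simp
  map_add' _ _ := by ext; simp

/-- `f_* : H³(G, A) → H³(G, A')`. -/
def H3.pushforward {ρ : G →* AddMonoid.End A} {ρ' : G →* AddMonoid.End A'} (f : A →+ A')
    (hf : ∀ x a, f (ρ x a) = ρ' x (f a)) : H3 ρ →+ H3 ρ' :=
  QuotientAddGroup.map _ _ (Z3.pushforward f hf) (by
    rintro h ⟨g, hg⟩
    refine ⟨fun x y => f (g x y), ?_⟩
    funext x y z
    have := congrArg f (congrFun (congrFun (congrFun hg x) y) z)
    simpa [d2, hf, Z3.pushforward] using this)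

end Functoriality

end GrpCohomology

open GrpCohomology

/-! ### The category `H³_Gr` -/

/-- Triples `(Π, A, [h])` of a group `Π`, a `Π`-module `A` and a class `[h] ∈ H³(Π, A)`. -/
structure H3Gr : Type (max (u + 1) (v + 1)) where
  /-- the group `Π` -/
  grp : Type u
  [instGroup : Group grp]
  /-- the abelian group `A` -/
  mod : Type v
  [instAddCommGroup : AddCommGroup mod]
  /-- the action of `Π` on `A` -/
  action : grp →* AddMonoid.End mod
  /-- the class `[h]` -/
  cls : H3 action

namespace H3Gr

attribute [instance] instGroup instAddCommGroup

/-- A morphism `(Π, A, [h]) → (Π', A', [h'])` is a pair of homomorphisms `φ : Π → Π'`, `f : A → A'`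
with `f (x a) = φ(x) f(a)` and `φ^* [h'] = f_* [h]` in `H³(Π, A')`. -/
@[ext]
structure Hom (X Y : H3Gr.{v, u}) where
  /-- the homomorphism `φ` of groups -/
  φ : X.grp →* Y.grp
  /-- the homomorphism `f` of abelian groups -/
  f : X.mod →+ Y.mod
  equivariant : ∀ x a, f (X.action x a) = Y.action (φ x) (f a)
  cls_eq : H3.pullback φ Y.action Y.cls =
    H3.pushforward (ρ' := Y.action.comp φ) f equivariant X.cls

/-- The identity morphism. -/
def Hom.id (X : H3Gr.{v, u}) : Hom X X where
  φ := MonoidHom.id _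
  f := AddMonoidHom.id _
  equivariant _ _ := rfl
  cls_eq := by
    obtain ⟨h, hh⟩ := QuotientAddGroup.mk_surjective X.cls
    rw [← hh]
    rfl

/-- The composition `(φ', f') ∘ (φ, f) = (φ' φ, f' f)`. -/
def Hom.comp {X Y Z : H3Gr.{v, u}} (p : Hom X Y) (q : Hom Y Z) : Hom X Z where
  φ := q.φ.comp p.φ
  f := q.f.comp p.f
  equivariant x a := by simp [p.equivariant, q.equivariant]
  cls_eq := by
    have hp := p.cls_eq
    have hq := q.cls_eq
    obtain ⟨h, hh⟩ := QuotientAddGroup.mk_surjective X.cls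
    obtain ⟨k, hk⟩ := QuotientAddGroup.mk_surjective Y.cls
    obtain ⟨l, hl⟩ := QuotientAddGroup.mk_surjective Z.cls
    rw [← hh, ← hk] at hp
    rw [← hk, ← hl] at hq
    rw [← hh, ← hl]
    obtain ⟨g, hg⟩ := QuotientAddGroup.eq.mp hp
    obtain ⟨g', hg'⟩ := QuotientAddGroup.eq.mp hq
    refine QuotientAddGroup.eq.mpr ⟨fun x y => q.f (g x y) + g' (p.φ x) (p.φ y), ?_⟩
    funext x y z
    have e1 := congrArg q.f (congrFun (congrFun (congrFun hg x) y) z)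
    have e2 := congrFun (congrFun (congrFun hg' (p.φ x)) (p.φ y)) (p.φ z)
    simp only [d2, Z3.pullback, Z3.pushforward, AddMonoidHom.coe_mk, ZeroHom.coe_mk,
      MonoidHom.coe_comp, Function.comp_apply, AddSubgroup.coe_subtype, Pi.add_apply, Pi.neg_apply, map_add, map_sub, map_neg, q.equivariant,
      map_mul, AddMonoidHom.coe_comp] at e1 e2 ⊢
    rw [← sub_eq_zero] at e1 e2 ⊢
    rw [← add_zero (0 : Z.mod)]
    nth_rewrite 1 [← e1]
    rw [← e2]
    abel

instance : Category H3Gr.{v, u} where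
  Hom := Hom
  id := Hom.id
  comp := Hom.comp

end H3Gr

/-! ### Gr-categories and their invariants -/

/-- A Gr-category: a monoidal category in which every morphism is an isomorphism and every object
is invertible for the tensor product. -/
class IsGrCategory (C : Type u) [Category.{v} C] [MonoidalCategory C] : Prop
    extends IsGroupoid C where
  exists_inverse : ∀ X : C, ∃ Y : C, Nonempty (X ⊗ Y ≅ 𝟙_ C) ∧ Nonempty (Y ⊗ X ≅ 𝟙_ C)

/-- `π₀ C`: the set of isomorphism classes of objects. Its multiplication is induced by the tensor
product (see `CategoryTheory.Skeleton.toSkeleton_tensorObj`); the class of `X` is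
`toSkeleton X`. -/
abbrev Pi0 (C : Type u) [Category.{v} C] [MonoidalCategory C] : Type u := Skeleton C

/-- `π₁ C`: the automorphisms of the unit object, with composition written additively. -/
abbrev Pi1 (C : Type u) [Category.{v} C] [MonoidalCategory C] : Type v := Additive (Aut (𝟙_ C))

namespace GrCategory

section Monoidal

variable {C : Type u} [Category.{v} C] [MonoidalCategory C]

instance : CommGroup (Aut (𝟙_ C)) where
  mul_comm a b := by
    have key (x y : 𝟙_ C ⟶ 𝟙_ C) : x ≫ y = y ≫ x := by
      have h := whisker_exchange x y
      simp only [id_whiskerLeft, whiskerRight_id, unitors_equal, unitors_inv_equal,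
        Category.assoc, Iso.inv_hom_id_assoc, cancel_epi] at h
      simpa [← Category.assoc] using h.symm
    exact Aut.ext (key b.hom a.hom)

/-- `γ_X(u) = l_X ∘ (u ⊗ id_X) ∘ l_X⁻¹` as a homomorphism. -/
def gammaHom (X : C) : Aut (𝟙_ C) →* Aut X where
  toFun u := (λ_ X).symm ≪≫ whiskerRightIso u X ≪≫ λ_ X
  map_one' := by
    apply Aut.ext
    change (λ_ X).inv ≫ 𝟙 (𝟙_ C) ▷ X ≫ (λ_ X).hom = 𝟙 X
    simp
  map_mul' u w := by
    apply Aut.ext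
    change (λ_ X).inv ≫ (w.hom ≫ u.hom) ▷ X ≫ (λ_ X).hom =
      ((λ_ X).inv ≫ w.hom ▷ X ≫ (λ_ X).hom) ≫ (λ_ X).inv ≫ u.hom ▷ X ≫ (λ_ X).hom
    simp

/-- `δ_X(u) = r_X ∘ (id_X ⊗ u) ∘ r_X⁻¹` as a homomorphism. -/
def delta (X : C) : Aut (𝟙_ C) →* Aut X where
  toFun u := (ρ_ X).symm ≪≫ whiskerLeftIso X u ≪≫ ρ_ X
  map_one' := by
    apply Aut.ext
    change (ρ_ X).inv ≫ X ◁ 𝟙 (𝟙_ C) ≫ (ρ_ X).hom = 𝟙 X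
    simp
  map_mul' u w := by
    apply Aut.ext
    change (ρ_ X).inv ≫ X ◁ (w.hom ≫ u.hom) ≫ (ρ_ X).hom =
      ((ρ_ X).inv ≫ X ◁ w.hom ≫ (ρ_ X).hom) ≫ (ρ_ X).inv ≫ X ◁ u.hom ≫ (ρ_ X).hom
    simp

lemma gammaHom_hom (X : C) (u : Aut (𝟙_ C)) :
    (gammaHom X u).hom = (λ_ X).inv ≫ u.hom ▷ X ≫ (λ_ X).hom := rfl

lemma delta_hom (X : C) (u : Aut (𝟙_ C)) :
    (delta X u).hom = (ρ_ X).inv ≫ X ◁ u.hom ≫ (ρ_ X).hom := rfl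

lemma gammaHom_naturality {X Y : C} (f : X ⟶ Y) (u : Aut (𝟙_ C)) :
    (gammaHom X u).hom ≫ f = f ≫ (gammaHom Y u).hom := by
  rw [gammaHom_hom, gammaHom_hom, Category.assoc, Category.assoc, ← leftUnitor_naturality,
    ← whisker_exchange_assoc, leftUnitor_inv_naturality_assoc]

lemma delta_naturality {X Y : C} (f : X ⟶ Y) (u : Aut (𝟙_ C)) :
    (delta X u).hom ≫ f = f ≫ (delta Y u).hom := by
  rw [delta_hom, delta_hom, Category.assoc, Category.assoc, ← rightUnitor_naturality,
    whisker_exchange_assoc, rightUnitor_inv_naturality_assoc]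

lemma gammaHom_whiskerRight (X Y : C) (u : Aut (𝟙_ C)) :
    (gammaHom X u).hom ▷ Y = (gammaHom (X ⊗ Y) u).hom := by
  simp [gammaHom_hom]

lemma whiskerLeft_delta (X Y : C) (u : Aut (𝟙_ C)) :
    X ◁ (delta Y u).hom = (delta (X ⊗ Y) u).hom := by
  simp [delta_hom]

lemma whiskerLeft_gammaHom (X Y : C) (u : Aut (𝟙_ C)) :
    X ◁ (gammaHom Y u).hom = (delta X u).hom ▷ Y := by
  simp [gammaHom_hom, delta_hom]

end Monoidal

section Gr

variable {C : Type u} [Category.{v} C] [MonoidalCategory C] [IsGrCategory C]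

noncomputable instance : Group (Pi0 C) where
  inv s := toSkeleton (IsGrCategory.exists_inverse ((fromSkeleton C).obj s)).choose
  inv_mul_cancel s := by
    have h := (IsGrCategory.exists_inverse ((fromSkeleton C).obj s)).choose_spec.2
    calc _ = toSkeleton (IsGrCategory.exists_inverse ((fromSkeleton C).obj s)).choose *
          toSkeleton ((fromSkeleton C).obj s) := by rw [toSkeleton_fromSkeleton_obj s]
      _ = 1 := by
        rw [← Skeleton.toSkeleton_tensorObj]
        exact congr_toSkeleton_of_iso h.some

instance (X : C) : (tensorRight X).IsEquivalence := by
  obtain ⟨Y, ⟨e⟩, ⟨e'⟩⟩ := IsGrCategory.exists_inverse X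
  exact (CategoryTheory.Equivalence.mk (tensorRight X) (tensorRight Y)
    ((rightUnitorNatIso C).symm ≪≫ (tensoringRight C).mapIso e.symm ≪≫ tensorRightTensor X Y)
    ((tensorRightTensor Y X).symm ≪≫ (tensoringRight C).mapIso e' ≪≫
      rightUnitorNatIso C)).isEquivalence_functor

lemma gammaHom_bijective (X : C) : Function.Bijective (gammaHom X) := by
  constructor
  · intro u w h
    apply Aut.ext
    apply (tensorRight X).map_injective
    have := congrArg Iso.hom h
    simpa [gammaHom_hom] using this
  · intro f
    obtain ⟨w, hw⟩ := (tensorRight X).map_surjective ((λ_ X).hom ≫ f.hom ≫ (λ_ X).inv)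
    refine ⟨asIso w, Aut.ext ?_⟩
    have hw' : w ▷ X = (λ_ X).hom ≫ f.hom ≫ (λ_ X).inv := hw
    change (λ_ X).inv ≫ w ▷ X ≫ (λ_ X).hom = f.hom
    simp [hw']

/-- In a Gr-category, `γ_X(u) = l_X ∘ (u ⊗ id_X) ∘ l_X⁻¹` is an isomorphism `Aut I ≃ Aut X`. -/
noncomputable def gamma (X : C) : Aut (𝟙_ C) ≃* Aut X :=
  MulEquiv.ofBijective (gammaHom X) (gammaHom_bijective X)

/-- The map `u ↦ γ_X⁻¹ (δ_X (u))`. -/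
noncomputable def act (X : C) : Aut (𝟙_ C) →* Aut (𝟙_ C) :=
  (gamma X).symm.toMonoidHom.comp (delta X)

lemma gammaHom_act (X : C) (u : Aut (𝟙_ C)) : gammaHom X (act X u) = delta X u :=
  (gamma X).apply_symm_apply _

lemma act_eq_of_iso {X Y : C} (e : X ≅ Y) : act X = act Y := by
  ext1 u
  apply (gammaHom_bijective X).1
  rw [gammaHom_act]
  apply Aut.ext
  rw [← cancel_mono e.hom, delta_naturality, gammaHom_naturality, gammaHom_act]

lemma act_unit : act (𝟙_ C) = MonoidHom.id _ := by
  ext1 u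
  apply (gammaHom_bijective (𝟙_ C)).1
  rw [gammaHom_act]
  apply Aut.ext
  simp [delta_hom, gammaHom_hom, unitors_equal, unitors_inv_equal]

lemma act_tensor (X Y : C) : act (X ⊗ Y) = (act X).comp (act Y) := by
  ext1 u
  apply (gammaHom_bijective (X ⊗ Y)).1
  rw [gammaHom_act]
  apply Aut.ext
  rw [← whiskerLeft_delta, ← gammaHom_act, whiskerLeft_gammaHom, ← gammaHom_act,
    gammaHom_whiskerRight]
  rfl

variable (C) in
/-- The action of `π₀ C` on `π₁ C`: `s u = γ_X⁻¹ (δ_X (u))` for any `X ∈ s`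
(see `pi1Action_toSkeleton`). -/
noncomputable def pi1Action : Pi0 C →* AddMonoid.End (Pi1 C) where
  toFun s := MonoidHom.toAdditive (act ((fromSkeleton C).obj s))
  map_one' := congrArg MonoidHom.toAdditive
    ((act_eq_of_iso (fromSkeletonToSkeletonIso (𝟙_ C))).trans act_unit)
  map_mul' s t := congrArg MonoidHom.toAdditive
    ((act_eq_of_iso (fromSkeletonToSkeletonIso
      ((fromSkeleton C).obj s ⊗ (fromSkeleton C).obj t))).trans (act_tensor _ _))

lemma pi1Action_toSkeleton (X : C) (u : Aut (𝟙_ C)) :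
    pi1Action C (toSkeleton X) (Additive.ofMul u) =
      Additive.ofMul ((gamma X).symm (delta X u)) := by
  change Additive.ofMul (act ((fromSkeleton C).obj (toSkeleton X)) u) = _
  rw [act_eq_of_iso (fromSkeletonToSkeletonIso X)]
  rfl

end Gr

/-! ### The cohomology class of the associativity constraint -/

/-- A choice of a representative `X_s` of every class `s ∈ π₀ C` and of isomorphisms
`X_s ⊗ X_t ≅ X_{st}`. -/
structure Stick (C : Type u) [Category.{v} C] [MonoidalCategory C] where
  /-- the representative `X_s` -/
  rep : Pi0 C → C
  toSkeleton_rep : ∀ s, toSkeleton (rep s) = s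
  /-- the isomorphism `X_s ⊗ X_t ≅ X_{st}` -/
  mulIso : ∀ s t, rep s ⊗ rep t ≅ rep (s * t)

instance (C : Type u) [Category.{v} C] [MonoidalCategory C] : Nonempty (Stick C) :=
  ⟨{ rep := (fromSkeleton C).obj
     toSkeleton_rep := toSkeleton_fromSkeleton_obj
     mulIso := fun s t => (fromSkeletonToSkeletonIso
      ((fromSkeleton C).obj s ⊗ (fromSkeleton C).obj t)).symm }⟩

namespace Stick

variable {C : Type u} [Category.{v} C] [MonoidalCategory C] (S : Stick C)

/-- The automorphism
`X_{s(tr)} ≅ X_s ⊗ X_{tr} ≅ X_s ⊗ (X_t ⊗ X_r) ≅ (X_s ⊗ X_t) ⊗ X_r ≅ X_{st} ⊗ X_r ≅ X_{(st)r}`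
of `X_{str}`. -/
noncomputable def assocAut (s t r : Pi0 C) : Aut (S.rep (s * t * r)) :=
  eqToIso (congrArg S.rep (mul_assoc s t r)) ≪≫
    (S.mulIso s (t * r)).symm ≪≫ whiskerLeftIso (S.rep s) (S.mulIso t r).symm ≪≫
    (α_ (S.rep s) (S.rep t) (S.rep r)).symm ≪≫
    whiskerRightIso (S.mulIso s t) (S.rep r) ≪≫ S.mulIso (s * t) r

/-- The associativity constraint `h : (π₀ C)³ → π₁ C` of the reduction of `C`: it is obtained
by transporting the associativity constraint of `C` along the chosen isomorphisms and identifying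
`Aut (X_{str})` with `π₁ C` through `γ`. -/
noncomputable def assocCochain [IsGrCategory C] : Pi0 C → Pi0 C → Pi0 C → Pi1 C :=
  fun s t r => Additive.ofMul ((gamma (S.rep (s * t * r))).symm (S.assocAut s t r))

end Stick

end GrCategory

open GrCategory

/-! ### The category of Gr-categories and Gr-functors -/

/-- A (bundled) Gr-category. -/
structure GrCat : Type (max (u + 1) (v + 1)) where
  /-- the type of objects -/
  carrier : Type u
  [instCategory : Category.{v} carrier]
  [instMonoidalCategory : MonoidalCategory carrier]
  [instIsGrCategory : IsGrCategory carrier]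

namespace GrCat

attribute [instance] instCategory instMonoidalCategory instIsGrCategory

/-- A Gr-functor: a functor with the structure of a (strong) monoidal functor. -/
structure GrFunctor (G G' : GrCat.{v, u}) where
  /-- the underlying functor -/
  functor : G.carrier ⥤ G'.carrier
  [monoidal : functor.Monoidal]

attribute [instance] GrFunctor.monoidal

lemma GrFunctor.mk_congr {G G' : GrCat.{v, u}} {F : G.carrier ⥤ G'.carrier}
    (a b : F.Monoidal)
    (hε : Functor.LaxMonoidal.ε (self := a.toLaxMonoidal) F =
      Functor.LaxMonoidal.ε (self := b.toLaxMonoidal) F)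
    (hμ : ∀ X Y, Functor.LaxMonoidal.μ (self := a.toLaxMonoidal) F X Y =
      Functor.LaxMonoidal.μ (self := b.toLaxMonoidal) F X Y) :
    @GrFunctor.mk G G' F a = @GrFunctor.mk G G' F b := by
  congr 1
  apply Functor.Monoidal.toLaxMonoidal_injective
  apply Functor.LaxMonoidal.ext
  · exact hε
  · funext X Y; exact hμ X Y

open Functor.LaxMonoidal in
/-- Gr-categories and Gr-functors, with the composition of functors and the composite monoidal
structure. -/
instance : Category GrCat.{v, u} where
  Hom := GrFunctor
  id G := { functor := 𝟭 G.carrier }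
  comp F K := { functor := F.functor ⋙ K.functor }
  id_comp F := by
    refine GrFunctor.mk_congr (F := F.functor) _ _ ?_ fun X Y => ?_
    · change ε F.functor ≫ F.functor.map (𝟙 _) = ε F.functor
      simp
    · change μ F.functor X Y ≫ F.functor.map (𝟙 _) = μ F.functor X Y
      simp
  comp_id F := by
    refine GrFunctor.mk_congr (F := F.functor) _ _ ?_ fun X Y => ?_
    · change 𝟙 _ ≫ ε F.functor = ε F.functor
      simp
    · change 𝟙 _ ≫ μ F.functor X Y = μ F.functor X Y
      simp
  assoc F K L := by
    refine GrFunctor.mk_congr (F := F.functor ⋙ K.functor ⋙ L.functor) _ _ ?_ fun X Y => ?_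
    · change ε L.functor ≫ L.functor.map (ε K.functor ≫ K.functor.map (ε F.functor)) =
        (ε L.functor ≫ L.functor.map (ε K.functor)) ≫
          L.functor.map (K.functor.map (ε F.functor))
      simp
    · change μ L.functor _ _ ≫ L.functor.map (μ K.functor _ _ ≫ K.functor.map (μ F.functor X Y)) =
        (μ L.functor _ _ ≫ L.functor.map (μ K.functor _ _)) ≫
          L.functor.map (K.functor.map (μ F.functor X Y))
      simp

variable {G G' : GrCat.{v, u}}

/-- `F₀ : π₀ G → π₀ G'`, `[X] ↦ [F X]`. -/
noncomputable def pi0Map (F : G ⟶ G') : Pi0 G.carrier →* Pi0 G'.carrier :=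
  Skeleton.monoidHom F.functor

lemma pi0Map_toSkeleton (F : G ⟶ G') (X : G.carrier) :
    pi0Map F (toSkeleton X) = toSkeleton (F.functor.obj X) :=
  F.functor.mapSkeleton_obj_toSkeleton X

/-- `F₁ : π₁ G → π₁ G'`, `u ↦ γ_{F I}⁻¹ (F u)`. -/
noncomputable def pi1Map (F : G ⟶ G') : Pi1 G.carrier →+ Pi1 G'.carrier :=
  MonoidHom.toAdditive
    ((gamma (F.functor.obj (𝟙_ G.carrier))).symm.toMonoidHom.comp (F.functor.mapAut (𝟙_ G.carrier)))

/-- Homotopy of Gr-functors: existence of a monoidal natural isomorphism. -/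
def Homotopic (F K : G ⟶ G') : Prop :=
  ∃ e : F.functor ≅ K.functor, NatTrans.IsMonoidal e.hom

lemma Homotopic.equivalence : Equivalence (Homotopic (G := G) (G' := G')) where
  refl F := ⟨Iso.refl _, inferInstanceAs (NatTrans.IsMonoidal (𝟙 F.functor))⟩
  symm := by
    rintro F K ⟨e, he⟩
    exact ⟨e.symm, inferInstanceAs (NatTrans.IsMonoidal e.inv)⟩
  trans := by
    rintro F K L ⟨e, he⟩ ⟨e', he'⟩
    exact ⟨e ≪≫ e', inferInstanceAs (NatTrans.IsMonoidal (e.hom ≫ e'.hom))⟩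

/-- `F` is a monoidal equivalence: it has an inverse Gr-functor up to homotopy. -/
def IsMonoidalEquivalence (F : G ⟶ G') : Prop :=
  ∃ K : G' ⟶ G, Homotopic (F ≫ K) (𝟙 G) ∧ Homotopic (K ≫ F) (𝟙 G')

/-- The set of homotopy classes of those Gr-functors `F : G ⟶ G'` with `d F = p`, for a functor
`d` from the category of Gr-categories to `H³_Gr`. -/
def HomClasses (d : GrCat.{v, u} ⥤ H3Gr.{v, u}) {G G' : GrCat.{v, u}}
    (p : d.obj G ⟶ d.obj G') : Type (max u v) :=
  Quotient (Setoid.comap (Subtype.val : {F : G ⟶ G' // d.map F = p} → (G ⟶ G'))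
    ⟨Homotopic, Homotopic.equivalence⟩)

end GrCat

/-! In a Gr-category, fix for all isomorphic `X`, `Y` a reference isomorphism, closed under
composition. Since `γ_X : Aut I → Aut X` is bijective, every morphism `X ⟶ Y` differs from the
reference one by a unique element of `π₁`, its value. Values add under composition and, for fixed
ends, determine the morphism. Under the tensor product, `f ⊗ g` has value `val f + [X] val g`, up to
a correction `defect` depending only on the source and target pairs. Hence every coherence diagram
becomes an equation in the abelian group `π₁`, checked by `abel`.

The value of the associator, freed of its defects, depends only on isomorphism classes, and the
pentagon says that it is a 3-cocycle (`assocFun`). Another choice of representatives and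
isomorphisms changes it by a coboundary.

Up to corrections by a function `p` of objects, a Gr-functor acts on values by `F₁`, and its tensor
constraint is a 2-cochain `g` with `φ^* h' = f_* h + ∂g` (`Describes.assocFun_eq`); its unit
constraint is then forced. Every such `g` occurs (`exists_describes_of_hom`), which gives fullness.
Two functors inducing the same `(φ, f)` are homotopic exactly when their cochains differ by some
`∂q` (`Describes.homotopic_iff`), so the homotopy classes form a torsor under `H²`.

Bijectivity of `F₀` and `F₁` gives an equivalence because values determine morphisms. Every triple
is realized by a skeletal category built from a cocycle, and `H²(ℤ/2, ℤ/2) ≠ 0` rules out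
faithfulness. -/

namespace GrCategory

/-! ### Values of morphisms in `π₁` -/

section Valuation

variable {C : Type u} [Category.{v} C]

/-- A coherent choice of isomorphisms between isomorphic objects. -/
noncomputable def refIso {X Y : C} (h : toSkeleton X = toSkeleton Y) : X ≅ Y :=
  (fromSkeletonToSkeletonIso X).symm ≪≫ eqToIso (congrArg (fromSkeleton C).obj h) ≪≫
    fromSkeletonToSkeletonIso Y

@[simp]
lemma refIso_hom_comp {X Y Z : C} (h : toSkeleton X = toSkeleton Y)
    (h' : toSkeleton Y = toSkeleton Z) :
    (refIso h).hom ≫ (refIso h').hom = (refIso (h.trans h')).hom := by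
  simp [refIso]

@[simp]
lemma refIso_self {X : C} (h : toSkeleton X = toSkeleton X) : (refIso h).hom = 𝟙 X := by
  simp [refIso]

variable [MonoidalCategory C] [IsGrCategory C]

lemma toSkeleton_unit : toSkeleton (𝟙_ C) = 1 := rfl

lemma pi1Action_mul (s t : Pi0 C) (a : Pi1 C) :
    pi1Action C (s * t) a = pi1Action C s (pi1Action C t a) := by
  rw [map_mul]
  rfl

lemma pi1Action_one (a : Pi1 C) : pi1Action C 1 a = a := by
  rw [map_one]
  rfl

lemma toSkeleton_eq_of_hom {X Y : C} (f : X ⟶ Y) : toSkeleton X = toSkeleton Y :=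
  congr_toSkeleton_of_iso (asIso f)

lemma pi1Action_toSkeleton_apply (X : C) (a : Pi1 C) :
    pi1Action C (toSkeleton X) a = Additive.ofMul (act X a.toMul) :=
  pi1Action_toSkeleton X a.toMul

/-- The element `a` of `π₁ C` with `f = γ_X(a) ≫ c`, for `c` the reference isomorphism. -/
noncomputable def val {X Y : C} (f : X ⟶ Y) : Pi1 C :=
  Additive.ofMul ((gamma X).symm (asIso f ≪≫ refIso (toSkeleton_eq_of_hom f).symm))

lemma gammaHom_val {X Y : C} (f : X ⟶ Y) (h : toSkeleton X = toSkeleton Y) :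
    (gammaHom X (val f).toMul).hom ≫ (refIso h).hom = f := by
  have : gammaHom X (val f).toMul = asIso f ≪≫ refIso (toSkeleton_eq_of_hom f).symm :=
    (gamma X).apply_symm_apply _
  rw [this]
  simp

lemma val_eq {X Y : C} {f : X ⟶ Y} {a : Pi1 C} (h : toSkeleton X = toSkeleton Y)
    (hf : (gammaHom X a.toMul).hom ≫ (refIso h).hom = f) : val f = a := by
  have h1 := (gammaHom_val f h).trans hf.symm
  rw [cancel_mono] at h1
  exact Additive.toMul.injective ((gammaHom_bijective X).1 (Aut.ext h1))

lemma val_gammaHom (X : C) (a : Pi1 C) : val (gammaHom X a.toMul).hom = a := by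
  apply val_eq rfl
  simp

lemma val_comp {X Y Z : C} (f : X ⟶ Y) (g : Y ⟶ Z) : val (f ≫ g) = val f + val g := by
  have hf := toSkeleton_eq_of_hom f
  have hg := toSkeleton_eq_of_hom g
  apply val_eq (hf.trans hg)
  conv_rhs => rw [← gammaHom_val f hf, ← gammaHom_val g hg]
  -- Multiplication in `Aut` is composition in reverse order, so the summands are swapped first.
  rw [add_comm, toMul_add, map_mul, Category.assoc, ← Category.assoc (refIso hf).hom,
    ← gammaHom_naturality, Category.assoc, refIso_hom_comp]
  exact Category.assoc _ _ _

@[simp]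
lemma val_id (X : C) : val (𝟙 X) = 0 := by
  simpa using val_comp (𝟙 X) (𝟙 X)

lemma val_inv {X Y : C} (e : X ≅ Y) : val e.inv = - val e.hom := by
  rw [eq_neg_iff_add_eq_zero, ← val_comp, e.inv_hom_id, val_id]

@[simp]
lemma val_eqToHom {X Y : C} (h : X = Y) : val (eqToHom h) = 0 := by
  subst h
  exact val_id X

lemma val_injective {X Y : C} {f g : X ⟶ Y} (h : val f = val g) : f = g := by
  have h' := toSkeleton_eq_of_hom f
  rw [← gammaHom_val f h', ← gammaHom_val g h', h]

/-- The morphism `X ⟶ Y` with value `a`. -/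
noncomputable def ofVal {X Y : C} (h : toSkeleton X = toSkeleton Y) (a : Pi1 C) : X ⟶ Y :=
  (gammaHom X a.toMul).hom ≫ (refIso h).hom

@[simp]
lemma val_ofVal {X Y : C} (h : toSkeleton X = toSkeleton Y) (a : Pi1 C) :
    val (ofVal h a) = a :=
  val_eq h rfl

/-- Since `γ_X(u) ▷ Z = γ_{X ⊗ Z}(u)`, whiskering on the right leaves the value unchanged; only the
reference isomorphism contributes a correction. -/
lemma val_whiskerRight_sub {X Y : C} (f : X ⟶ Y) (h : toSkeleton X = toSkeleton Y) (Z : C) :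
    val (f ▷ Z) = val f + val ((refIso h).hom ▷ Z) := by
  conv_lhs => rw [← gammaHom_val f h]
  rw [comp_whiskerRight, val_comp, gammaHom_whiskerRight, val_gammaHom]

/-- Since `Z ◁ γ_X(u) = δ_Z(u) ▷ X` and `δ_Z(u) = γ_Z([Z] u)`, whiskering on the left is where the
action of `π₀` enters. -/
lemma val_whiskerLeft_sub {X Y : C} (f : X ⟶ Y) (h : toSkeleton X = toSkeleton Y) (Z : C) :
    val (Z ◁ f) = pi1Action C (toSkeleton Z) (val f) + val (Z ◁ (refIso h).hom) := by
  conv_lhs => rw [← gammaHom_val f h]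
  rw [whiskerLeft_comp, val_comp, whiskerLeft_gammaHom, ← gammaHom_act, gammaHom_whiskerRight,
    pi1Action_toSkeleton_apply]
  congr 1
  exact val_gammaHom _ (Additive.ofMul _)

/-- The defect of compatibility of `val` with the tensor product. -/
noncomputable def defect (X Y : C) : Pi1 C :=
  val ((refIso (toSkeleton_fromSkeleton_obj (toSkeleton X)).symm).hom ⊗ₘ
    (refIso (toSkeleton_fromSkeleton_obj (toSkeleton Y)).symm).hom)

/-- The targets `P`, `Q` are variables because isomorphic objects have equal, but not definitionally
equal, chosen representatives. -/
lemma val_refIso_tensor {X Y P Q : C} (hP : P = (fromSkeleton C).obj (toSkeleton X))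
    (hQ : Q = (fromSkeleton C).obj (toSkeleton Y)) (h : toSkeleton X = toSkeleton P)
    (h' : toSkeleton Y = toSkeleton Q) :
    val ((refIso h).hom ⊗ₘ (refIso h').hom) = defect X Y := by
  subst hP hQ
  rfl

lemma val_whiskerRight {X Y : C} (f : X ⟶ Y) (Z : C) :
    val (f ▷ Z) = val f + defect X Z - defect Y Z := by
  have h := toSkeleton_eq_of_hom f
  have h1 : defect X Z = val ((refIso h).hom ▷ Z) + defect Y Z := by
    rw [← val_refIso_tensor (congrArg _ h.symm) rfl
      (h.trans (toSkeleton_fromSkeleton_obj (toSkeleton Y)).symm)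
      (toSkeleton_fromSkeleton_obj (toSkeleton Z)).symm, defect, ← val_comp,
      whiskerRight_comp_tensorHom]
    simp
  rw [val_whiskerRight_sub f h, h1]
  abel

lemma val_whiskerLeft {X Y : C} (f : X ⟶ Y) (Z : C) :
    val (Z ◁ f) = pi1Action C (toSkeleton Z) (val f) + defect Z X - defect Z Y := by
  have h := toSkeleton_eq_of_hom f
  have h1 : defect Z X = val (Z ◁ (refIso h).hom) + defect Z Y := by
    rw [← val_refIso_tensor rfl (congrArg _ h.symm)
      (toSkeleton_fromSkeleton_obj (toSkeleton Z)).symm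
      (h.trans (toSkeleton_fromSkeleton_obj (toSkeleton Y)).symm), defect, ← val_comp,
      whiskerLeft_comp_tensorHom]
    simp
  rw [val_whiskerLeft_sub f h, h1]
  abel

lemma val_tensorHom {X Y Z W : C} (f : X ⟶ Y) (g : Z ⟶ W) :
    val (f ⊗ₘ g) = val f + pi1Action C (toSkeleton X) (val g) + defect X Z - defect Y W := by
  rw [MonoidalCategory.tensorHom_def, val_comp, val_whiskerRight, val_whiskerLeft, toSkeleton_eq_of_hom f]
  abel

/-- The value of the associator, corrected by the defects of `val`. -/
noncomputable def assocVal (X Y Z : C) : Pi1 C :=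
  val (α_ X Y Z).inv - pi1Action C (toSkeleton X) (defect Y Z) - defect X (Y ⊗ Z) +
    defect X Y + defect (X ⊗ Y) Z

/-- Taking values in the naturality square of the associator, the values of `f`, `g`, `k` cancel and
only defects of the two ends remain. -/
lemma assocVal_eq_of_hom {X Y Z X' Y' Z' : C} (f : X ⟶ X') (g : Y ⟶ Y') (k : Z ⟶ Z') :
    assocVal X Y Z = assocVal X' Y' Z' := by
  have h := congrArg val (associator_inv_naturality f g k)
  simp only [val_comp, val_tensorHom, Skeleton.toSkeleton_tensorObj, map_add, map_sub, pi1Action_mul] at h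
  simp only [assocVal, ← toSkeleton_eq_of_hom f]
  rw [← sub_eq_zero] at h ⊢
  rw [← neg_eq_zero, ← h]
  abel

variable (C) in
/-- The associativity constraint, as a function of isomorphism classes. -/
noncomputable def assocFun (s t r : Pi0 C) : Pi1 C :=
  assocVal ((fromSkeleton C).obj s) ((fromSkeleton C).obj t) ((fromSkeleton C).obj r)

lemma val_associator_inv (X Y Z : C) :
    val (α_ X Y Z).inv = assocFun C (toSkeleton X) (toSkeleton Y) (toSkeleton Z) +
      pi1Action C (toSkeleton X) (defect Y Z) + defect X (Y ⊗ Z) - defect X Y -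
      defect (X ⊗ Y) Z := by
  rw [assocFun, assocVal_eq_of_hom (fromSkeletonToSkeletonIso X).hom
    (fromSkeletonToSkeletonIso Y).hom (fromSkeletonToSkeletonIso Z).hom, assocVal]
  abel

lemma val_associator_hom (X Y Z : C) :
    val (α_ X Y Z).hom = - (assocFun C (toSkeleton X) (toSkeleton Y) (toSkeleton Z) +
      pi1Action C (toSkeleton X) (defect Y Z) + defect X (Y ⊗ Z) - defect X Y -
      defect (X ⊗ Y) Z) := by
  rw [← val_associator_inv, val_inv, neg_neg]

variable (C) in
-- This is the pentagon read in values: all defects cancel.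
lemma assocFun_mem_Z3 : assocFun C ∈ Z3 (pi1Action C) := by
  change d3 (pi1Action C) (assocFun C) = 0
  funext x y z t
  obtain ⟨X, rfl⟩ : ∃ X : C, toSkeleton X = x := ⟨_, toSkeleton_fromSkeleton_obj x⟩
  obtain ⟨Y, rfl⟩ : ∃ X : C, toSkeleton X = y := ⟨_, toSkeleton_fromSkeleton_obj y⟩
  obtain ⟨Z, rfl⟩ : ∃ X : C, toSkeleton X = z := ⟨_, toSkeleton_fromSkeleton_obj z⟩
  obtain ⟨T, rfl⟩ : ∃ X : C, toSkeleton X = t := ⟨_, toSkeleton_fromSkeleton_obj t⟩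
  have h := congrArg val (pentagon_inv (W := X) (X := Y) (Y := Z) (Z := T))
  simp only [val_comp, val_whiskerLeft, val_whiskerRight, val_associator_inv,
    Skeleton.toSkeleton_tensorObj, map_add, map_sub, pi1Action_mul] at h
  change _ = (0 : Pi1 C)
  simp only [d3, AddMonoidHom.coe_mk, ZeroHom.coe_mk]
  rw [← sub_eq_zero] at h
  rw [← h]
  abel

variable (C) in
/-- The constant entering the values of the unit constraints. -/
noncomputable def unitVal : Pi1 C := val (λ_ (𝟙_ C)).hom - defect (𝟙_ C) (𝟙_ C)

/-- Naturality of `λ` at `λ_X` compares `λ_X` with `λ_{I ⊗ X}`, which is `λ_I ▷ X` preceded by an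
associator. So all unit constraints are governed by `assocFun` and the single constant `unitVal`. -/
lemma val_leftUnitor (X : C) :
    val (λ_ X).hom = defect (𝟙_ C) X + assocFun C 1 1 (toSkeleton X) + unitVal C := by
  have h1 := congrArg val (leftUnitor_tensor_hom (𝟙_ C) X)
  have h2 := congrArg val (leftUnitor_naturality (λ_ X).hom)
  simp only [val_comp, val_whiskerLeft, val_whiskerRight, val_associator_inv,
    toSkeleton_unit, pi1Action_one] at h1 h2
  -- With everything moved to one side, the goal is the sum of the two relations.
  rw [← sub_eq_zero] at h1 h2 ⊢
  rw [← add_zero (0 : Pi1 C)]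
  nth_rewrite 1 [← h1]
  rw [← h2, unitVal]
  abel

lemma val_rightUnitor (X : C) :
    val (ρ_ X).hom = defect X (𝟙_ C) - assocFun C (toSkeleton X) 1 1 +
      pi1Action C (toSkeleton X) (unitVal C) := by
  have h1 := congrArg val (rightUnitor_tensor_hom X (𝟙_ C))
  have h2 := congrArg val (rightUnitor_naturality (ρ_ X).hom)
  simp only [val_comp, val_whiskerLeft, val_whiskerRight, val_associator_hom,
    toSkeleton_unit, ← unitors_equal] at h1 h2
  rw [← sub_eq_zero] at h1 h2 ⊢
  rw [← add_zero (0 : Pi1 C)]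
  nth_rewrite 1 [← h1]
  rw [← h2, unitVal, map_sub]
  abel

lemma Stick.assocCochain_eq (S : Stick C) : ∃ t : Pi0 C → Pi0 C → Pi1 C,
    S.assocCochain = assocFun C + d2 (pi1Action C) t := by
  -- The defects left by the associator and by whiskering the chosen isomorphisms, together with the
  -- values of those isomorphisms, assemble into this coboundary.
  refine ⟨fun s t => defect (S.rep s) (S.rep t) - val (S.mulIso s t).hom, ?_⟩
  funext s t r
  have h : S.assocCochain s t r = val (S.assocAut s t r).hom := by
    have : gammaHom (S.rep (s * t * r)) (S.assocCochain s t r).toMul = S.assocAut s t r :=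
      (gamma _).apply_symm_apply _
    rw [← this, val_gammaHom]
  rw [h]
  simp only [Stick.assocAut, Iso.trans_hom, val_comp, eqToIso.hom, val_eqToHom, Iso.symm_hom,
    whiskerLeftIso_hom, whiskerRightIso_hom, val_whiskerLeft, val_whiskerRight, val_inv,
    val_associator_hom, S.toSkeleton_rep, Pi.add_apply, d2, AddMonoidHom.coe_mk, ZeroHom.coe_mk,
    map_neg, map_sub]
  abel

end Valuation

end GrCategory

namespace GrCategory

variable {C : Type u} [Category.{v} C] [MonoidalCategory C] [IsGrCategory C]

/-- The isomorphism `X ≅ Y` with value `a`. -/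
noncomputable def isoOfVal {X Y : C} (h : toSkeleton X = toSkeleton Y) (a : Pi1 C) : X ≅ Y :=
  asIso (ofVal h a)

@[simp]
lemma val_isoOfVal_hom {X Y : C} (h : toSkeleton X = toSkeleton Y) (a : Pi1 C) :
    val (isoOfVal h a).hom = a :=
  val_ofVal h a

lemma val_hom_unit (a : Pi1 C) : val a.toMul.hom = a := by
  conv_rhs => rw [← val_gammaHom (𝟙_ C) a]
  congr 1
  simp [gammaHom_hom, unitors_equal, unitors_inv_equal]

end GrCategory

/-! ### Gr-functors described by cochains -/

namespace GrCat

open Functor.LaxMonoidal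

variable {G G' : GrCat.{v, u}}

lemma pi1Map_apply (F : G ⟶ G') (a : Pi1 G.carrier) :
    pi1Map F a = val (F.functor.map a.toMul.hom) := by
  have : gammaHom (F.functor.obj (𝟙_ G.carrier)) (pi1Map F a).toMul =
      F.functor.mapAut (𝟙_ G.carrier) a.toMul := (gamma _).apply_symm_apply _
  rw [← val_gammaHom (F.functor.obj (𝟙_ G.carrier)) (pi1Map F a), this]
  rfl

lemma val_map_whiskerRight (F : G ⟶ G') {X Y : G.carrier} (k : X ⟶ Y) (Z : G.carrier) :
    val (F.functor.map (k ▷ Z)) = val (F.functor.map k) +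
      (defect (F.functor.obj X) (F.functor.obj Z) - val (μ F.functor X Z)) -
      (defect (F.functor.obj Y) (F.functor.obj Z) - val (μ F.functor Y Z)) := by
  have h := congrArg val (μ_natural_left F.functor k Z)
  rw [val_comp, val_comp, val_whiskerRight] at h
  rw [← sub_eq_zero] at h ⊢
  rw [← neg_eq_zero, ← h]
  abel

lemma val_map_whiskerLeft (F : G ⟶ G') {X Y : G.carrier} (k : X ⟶ Y) (Z : G.carrier) :
    val (F.functor.map (Z ◁ k)) =
      pi1Action G'.carrier (pi0Map F (toSkeleton Z)) (val (F.functor.map k)) +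
      (defect (F.functor.obj Z) (F.functor.obj X) - val (μ F.functor Z X)) -
      (defect (F.functor.obj Z) (F.functor.obj Y) - val (μ F.functor Z Y)) := by
  have h := congrArg val (μ_natural_right F.functor Z k)
  rw [val_comp, val_comp, val_whiskerLeft] at h
  rw [pi0Map_toSkeleton, ← sub_eq_zero]
  rw [← sub_eq_zero] at h
  rw [← neg_eq_zero, ← h]
  abel

/-- Applied to the unitors, this reduces the values of `F (γ_X a)` and `F (δ_X a)` to those of
whiskered morphisms, whose corrections cancel because source and target agree. -/
lemma val_map_conj (F : G ⟶ G') {X Y : G.carrier} (e : X ≅ Y) (k : Y ⟶ Y) :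
    val (F.functor.map (e.hom ≫ k ≫ e.inv)) = val (F.functor.map k) := by
  have h : val (F.functor.map e.inv) = - val (F.functor.map e.hom) := val_inv (F.functor.mapIso e)
  rw [F.functor.map_comp, F.functor.map_comp, val_comp, val_comp, h]
  abel

lemma val_map_gammaHom (F : G ⟶ G') (X : G.carrier) (a : Pi1 G.carrier) :
    val (F.functor.map (gammaHom X a.toMul).hom) = pi1Map F a := by
  have h := val_map_conj F (λ_ X).symm (a.toMul.hom ▷ X)
  rw [val_map_whiskerRight, add_sub_cancel_right, ← pi1Map_apply] at h
  exact h

lemma val_map_delta (F : G ⟶ G') (X : G.carrier) (a : Pi1 G.carrier) :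
    val (F.functor.map (delta X a.toMul).hom) =
      pi1Action G'.carrier (pi0Map F (toSkeleton X)) (pi1Map F a) := by
  have h := val_map_conj F (ρ_ X).symm (X ◁ a.toMul.hom)
  rw [val_map_whiskerLeft, add_sub_cancel_right, ← pi1Map_apply] at h
  exact h

lemma exists_toSkeleton {C : Type u} [Category.{v} C] (s : Skeleton C) :
    ∃ X : C, toSkeleton X = s := ⟨_, toSkeleton_fromSkeleton_obj s⟩

/-- Apply `F` to `γ_X([X] a) = δ_X(a)` and compare values. -/
lemma pi1Map_equivariant (F : G ⟶ G') (s : Pi0 G.carrier) (a : Pi1 G.carrier) :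
    pi1Map F (pi1Action G.carrier s a) = pi1Action G'.carrier (pi0Map F s) (pi1Map F a) := by
  obtain ⟨X, rfl⟩ := exists_toSkeleton s
  rw [← val_map_delta, ← val_map_gammaHom F X, pi1Action_toSkeleton_apply, toMul_ofMul,
    gammaHom_act]

/-- `F` induces `φ` and `f` on homotopy groups, acts on morphisms by `f` up to `p`, and its
tensor constraint is given, up to the same corrections, by the 2-cochain `g`. -/
structure Describes (F : G ⟶ G') (φ : Pi0 G.carrier →* Pi0 G'.carrier)
    (f : Pi1 G.carrier →+ Pi1 G'.carrier) (p : G.carrier → Pi1 G'.carrier)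
    (g : Pi0 G.carrier → Pi0 G.carrier → Pi1 G'.carrier) : Prop where
  obj X : toSkeleton (F.functor.obj X) = φ (toSkeleton X)
  map {X Y : G.carrier} (k : X ⟶ Y) : val (F.functor.map k) = f (val k) + p X - p Y
  mu X Y : val (μ F.functor X Y) = defect (F.functor.obj X) (F.functor.obj Y) -
    f (defect X Y) + g (toSkeleton X) (toSkeleton Y) + p X +
    pi1Action G'.carrier (φ (toSkeleton X)) (p Y) - p (X ⊗ Y)

/-- `F` need not preserve reference isomorphisms; `p X` is the value of the image of the one from
`X` to its chosen representative. -/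
lemma exists_map_val (F : G ⟶ G') : ∃ p : G.carrier → Pi1 G'.carrier,
    ∀ {X Y : G.carrier} (k : X ⟶ Y),
      val (F.functor.map k) = pi1Map F (val k) + p X - p Y := by
  let p (X : G.carrier) := val (F.functor.map
    (refIso (toSkeleton_fromSkeleton_obj (toSkeleton X)).symm).hom)
  have hp {X P : G.carrier} (hP : P = (fromSkeleton _).obj (toSkeleton X))
      (h : toSkeleton X = toSkeleton P) : val (F.functor.map (refIso h).hom) = p X := by
    subst hP
    rfl
  refine ⟨p, fun {X Y} k => ?_⟩
  have h := toSkeleton_eq_of_hom k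
  have h1 : p X = val (F.functor.map (refIso h).hom) + p Y := by
    rw [← hp (congrArg _ h.symm) (h.trans (toSkeleton_fromSkeleton_obj (toSkeleton Y)).symm),
      ← val_comp, ← Functor.map_comp, refIso_hom_comp]
  conv_lhs => rw [← gammaHom_val k h]
  rw [Functor.map_comp, val_comp, val_map_gammaHom, h1]
  abel

lemma exists_invariant₂ {C : Type*} [Category* C] {A : Type*} (m : C → C → A)
    (h : ∀ {X X' Y Y' : C} (_ : X ≅ X') (_ : Y ≅ Y'), m X Y = m X' Y') :
    ∃ g : Skeleton C → Skeleton C → A, ∀ X Y, m X Y = g (toSkeleton X) (toSkeleton Y) :=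
  ⟨fun s t => m ((fromSkeleton C).obj s) ((fromSkeleton C).obj t), fun X Y =>
    h (fromSkeletonToSkeletonIso X).symm (fromSkeletonToSkeletonIso Y).symm⟩

/-- Naturality of `μ` in both variables shows that its corrected value is an invariant of
isomorphism classes. -/
lemma exists_describes (F : G ⟶ G') : ∃ p g, Describes F (pi0Map F) (pi1Map F) p g := by
  obtain ⟨p, hp⟩ := exists_map_val F
  obtain ⟨g, hg⟩ := exists_invariant₂ (fun X Y : G.carrier => val (μ F.functor X Y) -
    defect (F.functor.obj X) (F.functor.obj Y) + pi1Map F (defect X Y) + p (X ⊗ Y) - p X -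
    pi1Action G'.carrier (pi0Map F (toSkeleton X)) (p Y)) (by
      intro X X' Y Y' e e'
      have h1 := val_map_whiskerRight F e.hom Y
      have h2 := val_map_whiskerLeft F e'.hom X'
      rw [hp, hp, val_whiskerRight] at h1
      rw [hp, hp, val_whiskerLeft, map_sub, map_add, pi1Map_equivariant] at h2
      rw [toSkeleton_eq_of_hom e.hom]
      simp only [map_add, map_sub] at h1 h2
      rw [← sub_eq_zero] at h1 h2 ⊢
      rw [← add_zero (0 : Pi1 G'.carrier)]
      nth_rewrite 1 [← h1]
      rw [← h2]
      abel)
  refine ⟨p, g, fun X => (pi0Map_toSkeleton F X).symm, hp, fun X Y => ?_⟩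
  rw [← hg]
  abel

variable {φ : Pi0 G.carrier →* Pi0 G'.carrier} {f : Pi1 G.carrier →+ Pi1 G'.carrier}
  {p p' : G.carrier → Pi1 G'.carrier} {g g' : Pi0 G.carrier → Pi0 G.carrier → Pi1 G'.carrier}
  {F K : G ⟶ G'}

namespace Describes

lemma pi0Map_eq (h : Describes F φ f p g) : pi0Map F = φ := by
  ext s
  obtain ⟨X, rfl⟩ := exists_toSkeleton s
  rw [pi0Map_toSkeleton, h.obj]

lemma pi1Map_eq (h : Describes F φ f p g) : pi1Map F = f := by
  refine AddMonoidHom.ext fun a => ?_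
  rw [pi1Map_apply, h.map, add_sub_cancel_right, val_hom_unit]

lemma equivariant (h : Describes F φ f p g) (s : Pi0 G.carrier) (a : Pi1 G.carrier) :
    f (pi1Action G.carrier s a) = pi1Action G'.carrier (φ s) (f a) := by
  rw [← h.pi0Map_eq, ← h.pi1Map_eq, pi1Map_equivariant]

/-- The relation between the associativity constraints of two Gr-categories that allows a tensor
constraint given by the cochain `g`. -/
lemma assocFun_eq (h : Describes F φ f p g) (x y z : Pi0 G.carrier) :
    assocFun G'.carrier (φ x) (φ y) (φ z) =
      f (assocFun G.carrier x y z) + d2 ((pi1Action G'.carrier).comp φ) g x y z := by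
  obtain ⟨X, rfl⟩ := exists_toSkeleton x
  obtain ⟨Y, rfl⟩ := exists_toSkeleton y
  obtain ⟨Z, rfl⟩ := exists_toSkeleton z
  have e := congrArg val (associativity F.functor X Y Z)
  simp only [val_comp, val_whiskerRight, val_whiskerLeft, val_associator_hom, h.mu, h.map, h.obj,
    Skeleton.toSkeleton_tensorObj, map_add, map_sub, map_neg, h.equivariant, map_mul φ,
    pi1Action_mul] at e
  simp only [d2, AddMonoidHom.coe_mk, ZeroHom.coe_mk, MonoidHom.comp_apply]
  rw [← sub_eq_zero] at e ⊢
  rw [← e]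
  abel

/-- Left unitality at the unit object determines `ε` from the tensor constraint, so the unit
constraint carries no independent information. -/
lemma val_ε (h : Describes F φ f p g) :
    val (ε F.functor) = unitVal G'.carrier - f (unitVal G.carrier) - g 1 1 - p (𝟙_ _) := by
  have e := congrArg val (left_unitality F.functor (𝟙_ G.carrier))
  have e' := h.assocFun_eq 1 1 1
  simp only [val_comp, val_whiskerRight, val_leftUnitor, h.mu, h.map, h.obj, toSkeleton_unit,
    map_add, map_one φ, pi1Action_one] at e
  simp only [d2, AddMonoidHom.coe_mk, ZeroHom.coe_mk, MonoidHom.comp_apply, map_one φ, mul_one,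
    pi1Action_one] at e'
  rw [e'] at e
  rw [← sub_eq_zero] at e ⊢
  rw [← neg_eq_zero, ← e]
  abel

/-- A natural isomorphism amounts to a function `q` on classes, its components having value `q + p -
p'`. Compatibility with `μ` is the cochain identity, and compatibility with `ε` is its case `(1,
1)`, where `∂q` equals `q 1`. -/
lemma homotopic_iff (h : Describes F φ f p g) (h' : Describes K φ f p' g') :
    Homotopic F K ↔ ∃ q, g = g' + d1 ((pi1Action G'.carrier).comp φ) q := by
  constructor
  · rintro ⟨e, he⟩
    let q (s : Pi0 G.carrier) := val (e.hom.app ((fromSkeleton _).obj s)) -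
      p ((fromSkeleton _).obj s) + p' ((fromSkeleton _).obj s)
    have hq (X : G.carrier) : val (e.hom.app X) = q (toSkeleton X) + p X - p' X := by
      have e1 := congrArg val (e.hom.naturality (fromSkeletonToSkeletonIso X).hom)
      rw [val_comp, val_comp, h.map, h'.map] at e1
      rw [← sub_eq_zero] at e1 ⊢
      rw [← e1]
      simp only [q]
      abel
    refine ⟨q, ?_⟩
    funext x y
    obtain ⟨X, rfl⟩ := exists_toSkeleton x
    obtain ⟨Y, rfl⟩ := exists_toSkeleton y
    have e2 := congrArg val (NatTrans.IsMonoidal.tensor (τ := e.hom) X Y)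
    simp only [val_comp, val_tensorHom, h.mu, h'.mu, hq, h.obj, Skeleton.toSkeleton_tensorObj,
      map_add, map_sub] at e2
    simp only [d1, Pi.add_apply, AddMonoidHom.coe_mk, ZeroHom.coe_mk, MonoidHom.comp_apply]
    rw [← sub_eq_zero] at e2 ⊢
    rw [← e2]
    abel
  · rintro ⟨q, rfl⟩
    refine ⟨NatIso.ofComponents (fun X => isoOfVal ((h.obj X).trans (h'.obj X).symm)
      (q (toSkeleton X) + p X - p' X)) ?_, ?_, ?_⟩
    · intro X Y k
      apply val_injective
      simp only [val_comp, val_isoOfVal_hom, h.map, h'.map, toSkeleton_eq_of_hom k]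
      abel
    · apply val_injective
      simp only [NatIso.ofComponents_hom_app, val_comp, val_isoOfVal_hom, h.val_ε, h'.val_ε]
      simp only [toSkeleton_unit, d1, Pi.add_apply, AddMonoidHom.coe_mk, ZeroHom.coe_mk,
        MonoidHom.comp_apply, map_one φ, pi1Action_one, mul_one]
      abel
    · intro X Y
      apply val_injective
      simp only [NatIso.ofComponents_hom_app, val_comp, val_tensorHom, val_isoOfVal_hom, h.mu,
        h'.mu, h.obj, Skeleton.toSkeleton_tensorObj, map_add, map_sub]
      simp only [d1, Pi.add_apply, AddMonoidHom.coe_mk, ZeroHom.coe_mk, MonoidHom.comp_apply]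
      abel

end Describes

/-! ### Gr-functors built from cochains -/

section Construction

variable (φ f g)

/-- The functor acting by `φ` on classes of objects and by `f` on values of morphisms. -/
noncomputable def functorOfHom : G.carrier ⥤ G'.carrier where
  obj X := (fromSkeleton _).obj (φ (toSkeleton X))
  map {X Y} k := ofVal (congrArg (fun s => toSkeleton ((fromSkeleton _).obj (φ s)))
    (toSkeleton_eq_of_hom k)) (f (val k))
  map_id X := val_injective (by simp)
  map_comp k l := val_injective (by simp [val_comp])

@[simp]
lemma toSkeleton_functorOfHom_obj (X : G.carrier) :
    toSkeleton ((functorOfHom φ f).obj X) = φ (toSkeleton X) :=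
  toSkeleton_fromSkeleton_obj _

@[simp]
lemma val_functorOfHom_map {X Y : G.carrier} (k : X ⟶ Y) :
    val ((functorOfHom φ f).map k) = f (val k) :=
  val_ofVal _ _

/-- In values, associativity is `hg`, and the left and right unit axioms are `hg` at `(1, 1, x)` and
`(x, 1, 1)`. -/
lemma exists_coreMonoidal
    (hf : ∀ s a, f (pi1Action G.carrier s a) = pi1Action G'.carrier (φ s) (f a))
    (hg : ∀ x y z, assocFun G'.carrier (φ x) (φ y) (φ z) =
      f (assocFun G.carrier x y z) + d2 ((pi1Action G'.carrier).comp φ) g x y z) :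
    ∃ c : (functorOfHom φ f).CoreMonoidal, ∀ X Y,
    val (c.μIso X Y).hom = defect ((functorOfHom φ f).obj X) ((functorOfHom φ f).obj Y) -
      f (defect X Y) + g (toSkeleton X) (toSkeleton Y) := by
  -- The only possible value, by `Describes.val_ε` with `p = 0`.
  obtain ⟨e₀, he₀⟩ : ∃ e₀ : 𝟙_ G'.carrier ≅ (functorOfHom φ f).obj (𝟙_ G.carrier),
      val e₀.hom = unitVal G'.carrier - f (unitVal G.carrier) - g 1 1 :=
    ⟨isoOfVal (by simp [toSkeleton_unit]) _, val_isoOfVal_hom _ _⟩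
  refine ⟨{
    εIso := e₀
    μIso := fun X Y => isoOfVal (by simp [Skeleton.toSkeleton_tensorObj])
      (defect ((functorOfHom φ f).obj X) ((functorOfHom φ f).obj Y) - f (defect X Y) +
        g (toSkeleton X) (toSkeleton Y))
    μIso_hom_natural_left := ?_
    μIso_hom_natural_right := ?_
    associativity := ?_
    left_unitality := ?_
    right_unitality := ?_ }, fun X Y => val_isoOfVal_hom _ _⟩
  · intro X Y k Z
    apply val_injective
    simp only [val_comp, val_isoOfVal_hom, val_whiskerRight, val_functorOfHom_map, map_add,
      map_sub, toSkeleton_eq_of_hom k]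
    abel
  · intro X Y Z k
    apply val_injective
    simp only [val_comp, val_isoOfVal_hom, val_whiskerLeft, val_functorOfHom_map, map_add,
      map_sub, toSkeleton_eq_of_hom k, hf, toSkeleton_functorOfHom_obj]
    abel
  · intro X Y Z
    apply val_injective
    have e := hg (toSkeleton X) (toSkeleton Y) (toSkeleton Z)
    simp only [d2, AddMonoidHom.coe_mk, ZeroHom.coe_mk, MonoidHom.comp_apply] at e
    simp only [val_comp, val_isoOfVal_hom, val_whiskerLeft, val_whiskerRight,
      val_functorOfHom_map, map_add, map_sub, map_neg, hf, toSkeleton_functorOfHom_obj,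
      val_associator_hom, Skeleton.toSkeleton_tensorObj, e]
    abel
  · intro X
    apply val_injective
    have e := hg 1 1 (toSkeleton X)
    simp only [d2, AddMonoidHom.coe_mk, ZeroHom.coe_mk, MonoidHom.comp_apply, map_one φ, one_mul,
      pi1Action_one] at e
    simp only [val_comp, val_isoOfVal_hom, val_whiskerRight, val_leftUnitor, he₀,
      val_functorOfHom_map, map_add, toSkeleton_functorOfHom_obj, toSkeleton_unit, e]
    abel
  · intro X
    apply val_injective
    have e := hg (toSkeleton X) 1 1
    simp only [d2, AddMonoidHom.coe_mk, ZeroHom.coe_mk, MonoidHom.comp_apply, map_one φ, mul_one]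
      at e
    simp only [val_comp, val_isoOfVal_hom, val_whiskerLeft, val_rightUnitor, he₀,
      val_functorOfHom_map, map_add, map_sub, toSkeleton_functorOfHom_obj, toSkeleton_unit, e, hf]
    abel

lemma exists_describes_of_hom
    (hf : ∀ s a, f (pi1Action G.carrier s a) = pi1Action G'.carrier (φ s) (f a))
    (hg : ∀ x y z, assocFun G'.carrier (φ x) (φ y) (φ z) =
      f (assocFun G.carrier x y z) + d2 ((pi1Action G'.carrier).comp φ) g x y z) :
    ∃ F : G ⟶ G', Describes F φ f 0 g := by
  obtain ⟨c, hc⟩ := exists_coreMonoidal φ f g hf hg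
  let _ := c.toMonoidal
  refine ⟨GrFunctor.mk (functorOfHom φ f), toSkeleton_functorOfHom_obj φ f, ?_, ?_⟩
  · intro X Y k
    exact (val_functorOfHom_map φ f k).trans (by simp)
  · intro X Y
    exact (hc X Y).trans (by simp)

end Construction

end GrCat

/-! ### The classifying functor -/

namespace GrCat

open Functor.LaxMonoidal

variable {G G' G'' : GrCat.{v, u}}

/-- The class of the associativity constraint. -/
noncomputable def assocClass (G : GrCat.{v, u}) : H3 (pi1Action G.carrier) :=
  H3.mk _ ⟨assocFun G.carrier, assocFun_mem_Z3 G.carrier⟩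

lemma assocCochain_mem_Z3 (S : Stick G.carrier) : S.assocCochain ∈ Z3 (pi1Action G.carrier) := by
  obtain ⟨t, ht⟩ := S.assocCochain_eq
  have key : d3 (pi1Action G.carrier) (d2 (pi1Action G.carrier) t) = 0 := by
    funext x y z w
    simp only [d2, d3, AddMonoidHom.coe_mk, ZeroHom.coe_mk, map_add, map_sub, pi1Action_mul,
      mul_assoc, Pi.zero_apply]
    abel
  rw [ht]
  exact add_mem (assocFun_mem_Z3 _) key

lemma assocClass_eq (S : Stick G.carrier) :
    assocClass G = H3.mk _ ⟨S.assocCochain, assocCochain_mem_Z3 S⟩ := by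
  obtain ⟨t, ht⟩ := S.assocCochain_eq
  refine QuotientAddGroup.eq.mpr ⟨t, ?_⟩
  simp [ht]

/-- The invariants `(π₀ G, π₁ G, [h_G])`. -/
noncomputable def invariants (G : GrCat.{v, u}) : H3Gr.{v, u} :=
  H3Gr.mk (Pi0 G.carrier) (Pi1 G.carrier) (pi1Action G.carrier) (assocClass G)

/-- The morphism of invariants induced by a Gr-functor. -/
noncomputable def invariantsMap (F : G ⟶ G') : invariants G ⟶ invariants G' where
  φ := pi0Map F
  f := pi1Map F
  equivariant := pi1Map_equivariant F
  cls_eq := by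
    obtain ⟨p, g, h⟩ := exists_describes F
    refine Eq.symm (QuotientAddGroup.eq.mpr ⟨g, ?_⟩)
    funext x y z
    exact eq_neg_add_of_add_eq (h.assocFun_eq x y z).symm

lemma pi0Map_id : pi0Map (𝟙 G) = MonoidHom.id _ := by
  ext s
  obtain ⟨X, rfl⟩ := exists_toSkeleton s
  exact pi0Map_toSkeleton _ X

lemma pi0Map_comp (F : G ⟶ G') (K : G' ⟶ G'') : pi0Map (F ≫ K) = (pi0Map K).comp (pi0Map F) := by
  ext s
  obtain ⟨X, rfl⟩ := exists_toSkeleton s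
  rw [MonoidHom.comp_apply, pi0Map_toSkeleton, pi0Map_toSkeleton, pi0Map_toSkeleton]
  rfl

lemma pi1Map_id : pi1Map (𝟙 G) = AddMonoidHom.id _ :=
  AddMonoidHom.ext fun a => (pi1Map_apply _ a).trans (val_hom_unit a)

lemma pi1Map_comp (F : G ⟶ G') (K : G' ⟶ G'') : pi1Map (F ≫ K) = (pi1Map K).comp (pi1Map F) := by
  refine AddMonoidHom.ext fun a => ?_
  obtain ⟨p, hp⟩ := exists_map_val K
  rw [AddMonoidHom.comp_apply, pi1Map_apply, pi1Map_apply F]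
  exact (hp _).trans (add_sub_cancel_right _ _)

/-- The functor `G ↦ (π₀ G, π₁ G, [h_G])`. -/
noncomputable def classifying : GrCat.{v, u} ⥤ H3Gr.{v, u} where
  obj := invariants
  map := invariantsMap
  map_id _ := H3Gr.Hom.ext pi0Map_id pi1Map_id
  map_comp F K := H3Gr.Hom.ext (pi0Map_comp F K) (pi1Map_comp F K)

/-- Naturality alone suffices: the value of the component at `I` cancels from the square at an
automorphism of `I`. -/
lemma classifying_map_eq_of_homotopic {F K : G ⟶ G'} (h : Homotopic F K) :
    classifying.map F = classifying.map K := by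
  obtain ⟨e, -⟩ := h
  refine H3Gr.Hom.ext ?_ ?_
  · refine MonoidHom.ext fun s => ?_
    obtain ⟨X, rfl⟩ := exists_toSkeleton s
    exact ((pi0Map_toSkeleton F X).trans (congr_toSkeleton_of_iso (e.app X))).trans
      (pi0Map_toSkeleton K X).symm
  · refine AddMonoidHom.ext fun a => ?_
    have h1 := congrArg val (e.hom.naturality a.toMul.hom)
    rw [val_comp, val_comp, add_comm, add_right_inj] at h1
    exact (pi1Map_apply F a).trans (h1.trans (pi1Map_apply K a).symm)

lemma Describes.map_eq {F : G ⟶ G'} {p : classifying.obj G ⟶ classifying.obj G'}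
    {c : G.carrier → Pi1 G'.carrier} {g : Pi0 G.carrier → Pi0 G.carrier → Pi1 G'.carrier}
    (h : Describes F p.φ p.f c g) : classifying.map F = p :=
  H3Gr.Hom.ext h.pi0Map_eq h.pi1Map_eq

instance : (classifying.{v, u}).Full where
  map_surjective {G G'} p := by
    obtain ⟨g, hg⟩ := QuotientAddGroup.eq.mp p.cls_eq.symm
    obtain ⟨F, hF⟩ := exists_describes_of_hom p.φ p.f g p.equivariant fun x y z => by
      have e := congrFun (congrFun (congrFun hg x) y) z
      exact (eq_neg_add_iff_add_eq.mp e).symm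
    exact ⟨F, hF.map_eq⟩

/-! ### Homotopy classes as a torsor under `H²` -/

section HomClasses

variable (φ : Pi0 G.carrier →* Pi0 G'.carrier) (f : Pi1 G.carrier →+ Pi1 G'.carrier)

lemma exists_describes_of_eq (F : {F : G ⟶ G' // pi0Map F = φ ∧ pi1Map F = f}) :
    ∃ g p, Describes F.1 φ f p g := by
  obtain ⟨F, rfl, rfl⟩ := F
  obtain ⟨p, g, h⟩ := exists_describes F
  exact ⟨g, p, h⟩

/-- A tensor constraint cochain of a Gr-functor inducing `(φ, f)`. -/
noncomputable def cochain (F : {F : G ⟶ G' // pi0Map F = φ ∧ pi1Map F = f}) :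
    Pi0 G.carrier → Pi0 G.carrier → Pi1 G'.carrier :=
  (exists_describes_of_eq φ f F).choose

lemma exists_describes_cochain (F : {F : G ⟶ G' // pi0Map F = φ ∧ pi1Map F = f}) :
    ∃ p, Describes F.1 φ f p (cochain φ f F) :=
  (exists_describes_of_eq φ f F).choose_spec

/-- One cochain is not a cocycle, but the coboundary of each is `φ^* h' - f_* h`. This is why a base
point `F₀` is needed below. -/
lemma cochain_sub_mem_Z2 (F F₀ : {F : G ⟶ G' // pi0Map F = φ ∧ pi1Map F = f}) :
    cochain φ f F - cochain φ f F₀ ∈ Z2 ((pi1Action G'.carrier).comp φ) := by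
  obtain ⟨p, h⟩ := exists_describes_cochain φ f F
  obtain ⟨p₀, h₀⟩ := exists_describes_cochain φ f F₀
  change d2 ((pi1Action G'.carrier).comp φ) (cochain φ f F - cochain φ f F₀) = 0
  rw [map_sub, sub_eq_zero]
  funext x y z
  exact add_left_cancel ((h.assocFun_eq x y z).symm.trans (h₀.assocFun_eq x y z))

/-- The class of the difference of the tensor constraints of two Gr-functors inducing `(φ, f)`. -/
noncomputable def diffClass (F₀ F : {F : G ⟶ G' // pi0Map F = φ ∧ pi1Map F = f}) :
    H2 ((pi1Action G'.carrier).comp φ) :=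
  QuotientAddGroup.mk ⟨cochain φ f F - cochain φ f F₀, cochain_sub_mem_Z2 φ f F F₀⟩

lemma diffClass_eq_iff (F₀ F K : {F : G ⟶ G' // pi0Map F = φ ∧ pi1Map F = f}) :
    diffClass φ f F₀ F = diffClass φ f F₀ K ↔ Homotopic F.1 K.1 := by
  obtain ⟨p, h⟩ := exists_describes_cochain φ f F
  obtain ⟨p', h'⟩ := exists_describes_cochain φ f K
  rw [eq_comm, h.homotopic_iff h', diffClass, diffClass, QuotientAddGroup.eq]
  refine exists_congr fun q => ?_
  change d1 ((pi1Action G'.carrier).comp φ) q =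
    -(cochain φ f K - cochain φ f F₀) + (cochain φ f F - cochain φ f F₀) ↔ _
  rw [neg_sub, sub_add_sub_comm, add_comm (cochain φ f F₀), add_sub_add_right_eq_sub,
    eq_sub_iff_add_eq', eq_comm]

lemma diffClass_surjective (hf : ∀ s a, f (pi1Action G.carrier s a) =
      pi1Action G'.carrier (φ s) (f a))
    (F₀ : {F : G ⟶ G' // pi0Map F = φ ∧ pi1Map F = f}) :
    Function.Surjective (diffClass φ f F₀) := by
  intro x
  obtain ⟨z, rfl⟩ := QuotientAddGroup.mk_surjective x
  obtain ⟨p₀, h₀⟩ := exists_describes_cochain φ f F₀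
  have hz : d2 ((pi1Action G'.carrier).comp φ) z.1 = 0 := z.2
  obtain ⟨F, hF⟩ := exists_describes_of_hom φ f (cochain φ f F₀ + z.1) hf
    fun x y z => by
      rw [map_add, hz, add_zero]
      exact h₀.assocFun_eq x y z
  let F' : {F : G ⟶ G' // pi0Map F = φ ∧ pi1Map F = f} := ⟨F, hF.pi0Map_eq, hF.pi1Map_eq⟩
  obtain ⟨p, h⟩ := exists_describes_cochain φ f F'
  -- The cochain chosen for `F` need not be the one used to build it; both describe `F`, which is
  -- homotopic to itself, so they are cohomologous.
  obtain ⟨q, hq⟩ := (hF.homotopic_iff h).mp (Homotopic.equivalence.refl F)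
  refine ⟨F', QuotientAddGroup.eq.mpr ⟨q, ?_⟩⟩
  change d1 ((pi1Action G'.carrier).comp φ) q =
    -(cochain φ f F' - cochain φ f F₀) + z.1
  rw [neg_sub, sub_add_eq_add_sub, hq, add_sub_cancel_left]

/-- Homotopy classes of Gr-functors inducing `p` correspond to second cohomology classes. -/
lemma nonempty_homClasses_equiv (p : classifying.obj G ⟶ classifying.obj G') :
    Nonempty (HomClasses classifying p ≃ H2 ((classifying.obj G').action.comp p.φ)) := by
  obtain ⟨F, hF⟩ := classifying.map_surjective p
  have key (K : {F : G ⟶ G' // classifying.map F = p}) :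
      pi0Map K.1 = p.φ ∧ pi1Map K.1 = p.f :=
    ⟨congrArg H3Gr.Hom.φ K.2, congrArg H3Gr.Hom.f K.2⟩
  let F₀ : {F : G ⟶ G' // pi0Map F = p.φ ∧ pi1Map F = p.f} := ⟨F, key ⟨F, hF⟩⟩
  refine ⟨Equiv.ofBijective (Quotient.lift (fun K => diffClass p.φ p.f F₀ ⟨K.1, key K⟩)
    fun K L h => (diffClass_eq_iff p.φ p.f F₀ ⟨K.1, key K⟩ ⟨L.1, key L⟩).mpr h) ⟨?_, ?_⟩⟩
  · rintro ⟨K⟩ ⟨L⟩ h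
    exact Quotient.sound ((diffClass_eq_iff p.φ p.f F₀ ⟨K.1, key K⟩ ⟨L.1, key L⟩).mp h)
  · intro x
    obtain ⟨K, hK⟩ := diffClass_surjective p.φ p.f p.equivariant F₀ x
    exact ⟨Quotient.mk _ ⟨K.1, H3Gr.Hom.ext K.2.1 K.2.2⟩, hK⟩

end HomClasses

/-! ### Isomorphisms of invariants and equivalences -/

section Equivalences

lemma isEquivalence_of_bijective (F : G ⟶ G') (h₀ : Function.Bijective (pi0Map F))
    (h₁ : Function.Bijective (pi1Map F)) : F.functor.IsEquivalence := by
  obtain ⟨p, hp⟩ := exists_map_val F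
  exact
    { faithful := ⟨fun {X Y k l} h => by
        have h' := congrArg val h
        rw [hp, hp, sub_left_inj, add_left_inj] at h'
        exact val_injective (h₁.1 h')⟩
      full := ⟨fun {X Y} l => by
        have hl := toSkeleton_eq_of_hom l
        rw [← pi0Map_toSkeleton, ← pi0Map_toSkeleton] at hl
        obtain ⟨a, ha⟩ := h₁.2 (val l - p X + p Y)
        -- Fullness also uses injectivity on `π₀`, to have a morphism `X ⟶ Y` at all.
        refine ⟨ofVal (h₀.1 hl) a, val_injective ?_⟩
        rw [hp, val_ofVal, ha]
        abel⟩
      essSurj := ⟨fun Y => by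
        obtain ⟨s, hs⟩ := h₀.2 (toSkeleton Y)
        obtain ⟨X, rfl⟩ := exists_toSkeleton s
        rw [pi0Map_toSkeleton] at hs
        exact ⟨X, ⟨isoOfVal hs 0⟩⟩⟩ }

lemma isEquivalence_of_isIso_map (F : G ⟶ G') [IsIso (classifying.map F)] :
    F.functor.IsEquivalence := by
  have h1 := IsIso.hom_inv_id (classifying.map F)
  have h2 := IsIso.inv_hom_id (classifying.map F)
  apply isEquivalence_of_bijective
  · exact Function.bijective_iff_has_inverse.mpr ⟨(inv (classifying.map F)).φ,
      fun x => DFunLike.congr_fun (congrArg H3Gr.Hom.φ h1) x,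
      fun x => DFunLike.congr_fun (congrArg H3Gr.Hom.φ h2) x⟩
  · exact Function.bijective_iff_has_inverse.mpr ⟨(inv (classifying.map F)).f,
      fun x => DFunLike.congr_fun (congrArg H3Gr.Hom.f h1) x,
      fun x => DFunLike.congr_fun (congrArg H3Gr.Hom.f h2) x⟩

lemma isMonoidalEquivalence_mk (e : G.carrier ≌ G'.carrier) [e.functor.Monoidal] :
    IsMonoidalEquivalence (G := G) (G' := G') (GrFunctor.mk e.functor) := by
  let _ := e.inverseMonoidal
  -- The inverse carries the lax structure of a right adjoint, for which unit and counit are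
  -- monoidal.
  have : e.IsMonoidal :=
    let _ := e.toAdjunction.rightAdjointLaxMonoidal
    (inferInstance : e.toAdjunction.IsMonoidal)
  exact ⟨GrFunctor.mk e.inverse,
    Homotopic.equivalence.symm ⟨e.unitIso, inferInstanceAs (NatTrans.IsMonoidal e.unit)⟩,
    ⟨e.counitIso, inferInstanceAs (NatTrans.IsMonoidal e.counit)⟩⟩

lemma isMonoidalEquivalence_of_isEquivalence (F : G ⟶ G') (hF : F.functor.IsEquivalence) :
    IsMonoidalEquivalence F :=
  let _ : F.functor.asEquivalence.functor.Monoidal := F.monoidal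
  isMonoidalEquivalence_mk F.functor.asEquivalence

lemma isIso_map_of_isMonoidalEquivalence {F : G ⟶ G'} (hF : IsMonoidalEquivalence F) :
    IsIso (classifying.map F) := by
  obtain ⟨K, h, h'⟩ := hF
  refine ⟨classifying.map K, ?_, ?_⟩
  · rw [← Functor.map_comp, classifying_map_eq_of_homotopic h, CategoryTheory.Functor.map_id]
  · rw [← Functor.map_comp, classifying_map_eq_of_homotopic h', CategoryTheory.Functor.map_id]

end Equivalences

end GrCat

/-! ### The Gr-category of a 3-cocycle -/

namespace GrCategory

/-- The skeletal Gr-category of a 3-cocycle `h : G³ → A`: its objects are the elements of `G`. -/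
structure CocycleCat {G : Type u} {A : Type v} [Group G] [AddCommGroup A]
    {ρ : G →* AddMonoid.End A} (h : Z3 ρ) : Type u where
  /-- the element of the group -/
  pt : G

namespace CocycleCat

variable {G : Type u} {A : Type v} [Group G] [AddCommGroup A] {ρ : G →* AddMonoid.End A}
  {h : Z3 ρ}

lemma cocycle_apply (x y z t : G) :
    ρ x (h.1 y z t) - h.1 (x * y) z t + h.1 x (y * z) t - h.1 x y (z * t) + h.1 x y z = 0 :=
  congrFun (congrFun (congrFun (congrFun h.2 x) y) z) t

/-- The subtype has a constant predicate: a copy of `A` when the two elements agree, empty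
otherwise. -/
instance : Category.{v} (CocycleCat h) where
  Hom X Y := {_a : A // X.pt = Y.pt}
  id _ := ⟨0, rfl⟩
  comp f g := ⟨f.1 + g.1, f.2.trans g.2⟩
  id_comp _ := Subtype.ext (zero_add _)
  comp_id _ := Subtype.ext (add_zero _)
  assoc _ _ _ := Subtype.ext (add_assoc _ _ _)

@[ext]
lemma hom_ext {X Y : CocycleCat h} {f g : X ⟶ Y} (e : f.1 = g.1) : f = g := Subtype.ext e

@[simp]
lemma id_val (X : CocycleCat h) : (𝟙 X : X ⟶ X).1 = 0 := rfl

@[simp]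
lemma comp_val {X Y Z : CocycleCat h} (f : X ⟶ Y) (g : Y ⟶ Z) : (f ≫ g).1 = f.1 + g.1 := rfl

/-- The isomorphism of value `a` between two objects with the same underlying element. -/
def mkIso {X Y : CocycleCat h} (e : X.pt = Y.pt) (a : A) : X ≅ Y where
  hom := ⟨a, e⟩
  inv := ⟨-a, e.symm⟩
  hom_inv_id := Subtype.ext (add_neg_cancel a)
  inv_hom_id := Subtype.ext (neg_add_cancel a)

@[simp]
lemma mkIso_hom_val {X Y : CocycleCat h} (e : X.pt = Y.pt) (a : A) : (mkIso e a).hom.1 = a := rfl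

@[simp]
lemma mkIso_inv_val {X Y : CocycleCat h} (e : X.pt = Y.pt) (a : A) : (mkIso e a).inv.1 = -a := rfl

/-- The cocycle is not assumed normalized; the unit constraints are chosen so that the triangle is
the cocycle identity at `(x, 1, 1, y)`. The associator `α` is inverse to the constraint `a`, hence
the sign of `h`. -/
instance : MonoidalCategoryStruct (CocycleCat h) where
  tensorObj X Y := ⟨X.pt * Y.pt⟩
  tensorUnit := ⟨1⟩
  whiskerLeft X _ _ f := ⟨ρ X.pt f.1, congrArg (X.pt * ·) f.2⟩
  whiskerRight f Y := ⟨f.1, congrArg (· * Y.pt) f.2⟩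
  tensorHom {X _ _ _} f g := ⟨f.1 + ρ X.pt g.1, congrArg₂ (· * ·) f.2 g.2⟩
  associator X Y Z := mkIso (mul_assoc X.pt Y.pt Z.pt) (-h.1 X.pt Y.pt Z.pt)
  leftUnitor X := mkIso (one_mul X.pt) (h.1 1 1 X.pt)
  rightUnitor X := mkIso (mul_one X.pt) (-h.1 X.pt 1 1)

@[simp] lemma tensorObj_pt (X Y : CocycleCat h) : (X ⊗ Y).pt = X.pt * Y.pt := rfl

@[simp] lemma tensorUnit_pt : (𝟙_ (CocycleCat h)).pt = 1 := rfl

@[simp]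
lemma whiskerLeft_val (X : CocycleCat h) {Y Z : CocycleCat h} (f : Y ⟶ Z) :
    (X ◁ f).1 = ρ X.pt f.1 := rfl

@[simp]
lemma whiskerRight_val {X Y : CocycleCat h} (f : X ⟶ Y) (Z : CocycleCat h) :
    (f ▷ Z).1 = f.1 := rfl

@[simp]
lemma tensorHom_val {X Y Z W : CocycleCat h} (f : X ⟶ Y) (g : Z ⟶ W) :
    (f ⊗ₘ g).1 = f.1 + ρ X.pt g.1 := rfl

@[simp]
lemma associator_hom_val (X Y Z : CocycleCat h) :
    (α_ X Y Z).hom.1 = -h.1 X.pt Y.pt Z.pt := rfl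

@[simp]
lemma associator_inv_val (X Y Z : CocycleCat h) :
    (α_ X Y Z).inv.1 = h.1 X.pt Y.pt Z.pt := neg_neg _

@[simp] lemma leftUnitor_hom_val (X : CocycleCat h) : (λ_ X).hom.1 = h.1 1 1 X.pt := rfl

@[simp] lemma leftUnitor_inv_val (X : CocycleCat h) : (λ_ X).inv.1 = -h.1 1 1 X.pt := rfl

@[simp] lemma rightUnitor_hom_val (X : CocycleCat h) : (ρ_ X).hom.1 = -h.1 X.pt 1 1 := rfl

@[simp] lemma rightUnitor_inv_val (X : CocycleCat h) : (ρ_ X).inv.1 = h.1 X.pt 1 1 := neg_neg _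

lemma action_mul (x y : G) (a : A) : ρ (x * y) a = ρ x (ρ y a) := by
  rw [map_mul]
  rfl

lemma action_one (a : A) : ρ 1 a = a := by
  rw [map_one]
  rfl

instance : MonoidalCategory (CocycleCat h) where
  tensorHom_def {X Y _ _} f g := by
    ext
    have e : X.pt = Y.pt := f.2
    simp [e]
  id_tensorHom_id X Y := by
    ext
    simp
  tensorHom_comp_tensorHom {X₁ Y₁ Z₁ X₂ Y₂ Z₂} f₁ f₂ g₁ g₂ := by
    ext
    have e : X₁.pt = Y₁.pt := f₁.2
    simp only [tensorHom_val, comp_val, map_add, e]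
    abel
  whiskerLeft_id X Y := by
    ext
    simp
  id_whiskerRight X Y := by
    ext
    simp
  associator_naturality {X₁ X₂ X₃ Y₁ Y₂ Y₃} f₁ f₂ f₃ := by
    ext
    have e₁ : X₁.pt = Y₁.pt := f₁.2
    have e₂ : X₂.pt = Y₂.pt := f₂.2
    have e₃ : X₃.pt = Y₃.pt := f₃.2
    simp only [comp_val, tensorHom_val, associator_hom_val, tensorObj_pt, map_add, action_mul,
      e₁, e₂, e₃]
    abel
  leftUnitor_naturality {X Y} f := by
    ext
    have e : X.pt = Y.pt := f.2
    simp only [comp_val, whiskerLeft_val, leftUnitor_hom_val, tensorUnit_pt, action_one, e]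
    abel
  rightUnitor_naturality {X Y} f := by
    ext
    have e : X.pt = Y.pt := f.2
    simp only [comp_val, whiskerRight_val, rightUnitor_hom_val, e]
    abel
  pentagon W X Y Z := by
    ext
    have e := cocycle_apply (h := h) W.pt X.pt Y.pt Z.pt
    simp only [comp_val, whiskerLeft_val, whiskerRight_val, associator_hom_val, tensorObj_pt,
      map_neg]
    rw [← sub_eq_zero, ← neg_eq_zero, ← e]
    abel
  triangle X Y := by
    ext
    have e := cocycle_apply (h := h) X.pt 1 1 Y.pt
    simp only [mul_one, one_mul] at e
    simp only [comp_val, whiskerLeft_val, whiskerRight_val, associator_hom_val, tensorUnit_pt,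
      leftUnitor_hom_val, rightUnitor_hom_val]
    rw [← sub_eq_zero, ← e]
    abel

instance : IsGrCategory (CocycleCat h) where
  all_isIso f := (mkIso f.2 f.1).isIso_hom
  exists_inverse X := ⟨⟨X.pt⁻¹⟩, ⟨mkIso (mul_inv_cancel X.pt) 0⟩, ⟨mkIso (inv_mul_cancel X.pt) 0⟩⟩

lemma toSkeleton_eq_iff {X Y : CocycleCat h} : toSkeleton X = toSkeleton Y ↔ X.pt = Y.pt :=
  ⟨fun e => (refIso e).hom.2, fun e => congr_toSkeleton_of_iso (mkIso e 0)⟩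

lemma gammaHom_val (X : CocycleCat h) (u : Aut (𝟙_ (CocycleCat h))) :
    (gammaHom X u).hom.1 = u.hom.1 := by
  rw [gammaHom_hom, comp_val, comp_val, whiskerRight_val, leftUnitor_hom_val, leftUnitor_inv_val]
  abel

lemma delta_val (X : CocycleCat h) (u : Aut (𝟙_ (CocycleCat h))) :
    (delta X u).hom.1 = ρ X.pt u.hom.1 := by
  rw [delta_hom, comp_val, comp_val, whiskerLeft_val, rightUnitor_hom_val, rightUnitor_inv_val]
  abel

variable (h)

/-- The group of isomorphism classes of objects is the original group. -/
noncomputable def pi0Equiv : Pi0 (CocycleCat h) ≃* G where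
  toFun s := ((fromSkeleton _).obj s).pt
  invFun x := toSkeleton ⟨x⟩
  left_inv s := (toSkeleton_eq_iff.mpr rfl).trans (toSkeleton_fromSkeleton_obj s)
  right_inv x := (fromSkeletonToSkeletonIso (C := CocycleCat h) ⟨x⟩).hom.2
  map_mul' s t := (fromSkeletonToSkeletonIso
    ((fromSkeleton (CocycleCat h)).obj s ⊗ (fromSkeleton _).obj t)).hom.2

/-- The automorphism group of the unit object is the original module. -/
def pi1Equiv : Pi1 (CocycleCat h) ≃+ A where
  toFun a := a.toMul.hom.1
  invFun a := Additive.ofMul (mkIso rfl a)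
  left_inv _ := Additive.toMul.injective (Aut.ext rfl)
  right_inv _ := rfl
  map_add' a b := add_comm b.toMul.hom.1 a.toMul.hom.1

lemma pi1Equiv_action (s : Pi0 (CocycleCat h)) (a : Pi1 (CocycleCat h)) :
    pi1Equiv h (pi1Action (CocycleCat h) s a) = ρ (pi0Equiv h s) (pi1Equiv h a) := by
  conv_lhs => rw [← toSkeleton_fromSkeleton_obj s, pi1Action_toSkeleton_apply]
  have e := congrArg (fun i => i.hom.1) (gammaHom_act ((fromSkeleton _).obj s) a.toMul)
  rw [gammaHom_val, delta_val] at e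
  exact e

/-- The stick whose isomorphisms have value zero. -/
noncomputable def stick : Stick (CocycleCat h) where
  rep := (fromSkeleton _).obj
  toSkeleton_rep := toSkeleton_fromSkeleton_obj
  mulIso s t := mkIso ((pi0Equiv h).map_mul s t).symm 0

lemma eqToHom_val {X Y : CocycleCat h} (e : X = Y) : (eqToHom e).1 = 0 := by
  subst e
  rfl

lemma stick_mulIso_hom_val (s t : Pi0 (CocycleCat h)) : ((stick h).mulIso s t).hom.1 = 0 := rfl

lemma stick_mulIso_inv_val (s t : Pi0 (CocycleCat h)) : ((stick h).mulIso s t).inv.1 = 0 :=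
  neg_zero

/-- All the isomorphisms composed in `assocAut` have value zero, except the associator. -/
lemma pi1Equiv_assocCochain (s t r : Pi0 (CocycleCat h)) :
    pi1Equiv h ((stick h).assocCochain s t r) =
      h.1 (pi0Equiv h s) (pi0Equiv h t) (pi0Equiv h r) := by
  have e : gammaHom _ ((stick h).assocCochain s t r).toMul = (stick h).assocAut s t r :=
    (gamma _).apply_symm_apply _
  have e' := congrArg (fun i => i.hom.1) e
  rw [gammaHom_val] at e'
  refine e'.trans ?_
  simp only [Stick.assocAut, Iso.trans_hom, comp_val, eqToIso.hom, eqToHom_val,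
    Iso.symm_hom, whiskerLeftIso_hom, whiskerRightIso_hom, stick_mulIso_hom_val,
    stick_mulIso_inv_val, whiskerLeft_val, whiskerRight_val, associator_inv_val, map_zero,
    zero_add, add_zero]
  rfl

end CocycleCat

end GrCategory

/-! ### Isomorphisms of triples, and a nonzero class in `H²(ℤ/2, ℤ/2)` -/

namespace H3Gr

/-- Isomorphisms of groups and of modules that identify two cocycles give an isomorphism. -/
lemma nonempty_iso {G G' : Type u} {A A' : Type v} [Group G] [Group G'] [AddCommGroup A]
    [AddCommGroup A'] {ρ : G →* AddMonoid.End A} {ρ' : G' →* AddMonoid.End A'} (c : H3 ρ)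
    (c' : H3 ρ') (φ : G ≃* G') (f : A ≃+ A') (hf : ∀ x a, f (ρ x a) = ρ' (φ x) (f a)) (k : Z3 ρ)
    (l : Z3 ρ') (hk : c = H3.mk _ k) (hl : c' = H3.mk _ l)
    (hkl : ∀ x y z, f (k.1 x y z) = l.1 (φ x) (φ y) (φ z)) :
    Nonempty (H3Gr.mk G A ρ c ≅ H3Gr.mk G' A' ρ' c') := by
  let p : Hom (H3Gr.mk G A ρ c) (H3Gr.mk G' A' ρ' c') :=
    { φ := φ.toMonoidHom
      f := f.toAddMonoidHom
      equivariant := hf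
      cls_eq := by
        subst hk hl
        refine congrArg QuotientAddGroup.mk (Subtype.ext ?_)
        funext x y z
        exact (hkl x y z).symm }
  let q : Hom (H3Gr.mk G' A' ρ' c') (H3Gr.mk G A ρ c) :=
    { φ := φ.symm.toMonoidHom
      f := f.symm.toAddMonoidHom
      equivariant := fun y a => f.injective (by
        change f (f.symm _) = f (ρ (φ.symm y) (f.symm a))
        rw [hf, f.apply_symm_apply, f.apply_symm_apply, φ.apply_symm_apply])
      cls_eq := by
        subst hk hl
        refine congrArg QuotientAddGroup.mk (Subtype.ext ?_)
        funext x y z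
        refine f.injective ((hkl _ _ _).trans ?_)
        change l.1 (φ (φ.symm x)) (φ (φ.symm y)) (φ (φ.symm z)) = f (f.symm (l.1 x y z))
        simp }
  exact ⟨⟨p, q, Hom.ext (MonoidHom.ext φ.symm_apply_apply) (AddMonoidHom.ext f.symm_apply_apply),
    Hom.ext (MonoidHom.ext φ.apply_symm_apply) (AddMonoidHom.ext f.apply_symm_apply)⟩⟩

/-- The group and the module of order two, with trivial action and trivial class. -/
def orderTwo : H3Gr.{v, u} where
  grp := ULift (Multiplicative (ZMod 2))
  mod := ULift (ZMod 2)
  action := 1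
  cls := 0

/-- The product of `ZMod 2`, as a 2-cochain. -/
def orderTwoCochain (x y : orderTwo.{v, u}.grp) : orderTwo.{v, u}.mod :=
  ULift.up (x.down.toAdd * y.down.toAdd)

lemma d2_orderTwoCochain : d2 orderTwo.{v, u}.action orderTwoCochain = 0 := by
  funext x y z
  apply ULift.down_injective
  change y.down.toAdd * z.down.toAdd - (x.down.toAdd + y.down.toAdd) * z.down.toAdd +
    x.down.toAdd * (y.down.toAdd + z.down.toAdd) - x.down.toAdd * y.down.toAdd = 0
  ring

/-- If `∂t` were the product, `(0, 0)` would give `t 0 = 0`, and then `(1, 1)` would give `2 t 1 =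
1` in `ℤ/2`. -/
lemma orderTwoCochain_ne_d1 (t : orderTwo.{v, u}.grp → orderTwo.{v, u}.mod) :
    d1 orderTwo.action t ≠ orderTwoCochain := by
  intro ht
  have h (x y : ZMod 2) : (t ⟨.ofAdd y⟩).down - (t ⟨.ofAdd (x + y)⟩).down + (t ⟨.ofAdd x⟩).down =
      x * y :=
    congrArg ULift.down (congrFun (congrFun ht ⟨.ofAdd x⟩) ⟨.ofAdd y⟩)
  have h0 := h 0 0
  have h1 := h 1 1
  rw [show (1 : ZMod 2) + 1 = 0 from rfl] at h1
  rw [add_zero, sub_self, zero_add, mul_zero] at h0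
  rw [h0, sub_zero, CharTwo.add_self_eq_zero, mul_one] at h1
  exact zero_ne_one h1

lemma exists_cocycle_ne_d1 {X : H3Gr.{v, u}} (e : X ≅ orderTwo.{v, u}) :
    ∃ z, d2 X.action z = 0 ∧ ∀ t, d1 X.action t ≠ z := by
  have hφ (x) : e.hom.φ (e.inv.φ x) = x := DFunLike.congr_fun (congrArg Hom.φ e.inv_hom_id) x
  have hφ' (x) : e.inv.φ (e.hom.φ x) = x := DFunLike.congr_fun (congrArg Hom.φ e.hom_inv_id) x
  have hf (a) : e.hom.f (e.inv.f a) = a := DFunLike.congr_fun (congrArg Hom.f e.inv_hom_id) a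
  refine ⟨fun x y => e.inv.f (orderTwoCochain (e.hom.φ x) (e.hom.φ y)), ?_, fun t ht => ?_⟩
  · funext x y z
    have h := congrArg e.inv.f (congrFun (congrFun (congrFun d2_orderTwoCochain
      (e.hom.φ x)) (e.hom.φ y)) (e.hom.φ z))
    simpa [d2, e.inv.equivariant, hφ'] using h
  · refine orderTwoCochain_ne_d1 (fun x => e.hom.f (t (e.inv.φ x))) ?_
    funext x y
    have h := congrArg e.hom.f (congrFun (congrFun ht (e.inv.φ x)) (e.inv.φ y))
    simpa [d1, e.hom.equivariant, hφ, hf] using h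

end H3Gr

/-! ### Essential surjectivity and failure of faithfulness -/

namespace GrCat

lemma nonempty_iso_cocycleCat {Γ : Type u} {A : Type v} [Group Γ] [AddCommGroup A]
    {ρ : Γ →* AddMonoid.End A} (l : Z3 ρ) :
    Nonempty (H3Gr.mk (Pi0 (CocycleCat l)) (Pi1 (CocycleCat l)) (pi1Action (CocycleCat l))
      (assocClass ⟨CocycleCat l⟩) ≅ H3Gr.mk Γ A ρ (H3.mk ρ l)) :=
  H3Gr.nonempty_iso _ _ (CocycleCat.pi0Equiv l) (CocycleCat.pi1Equiv l)
    (CocycleCat.pi1Equiv_action l)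
    ⟨_, assocCochain_mem_Z3 (G := ⟨CocycleCat l⟩) (CocycleCat.stick l)⟩ l
    (assocClass_eq (G := ⟨CocycleCat l⟩) (CocycleCat.stick l)) rfl
    (CocycleCat.pi1Equiv_assocCochain l)

instance : (classifying.{v, u}).EssSurj where
  mem_essImage Y := by
    obtain ⟨Γ, A, ρ, c⟩ := Y
    obtain ⟨l, rfl⟩ := QuotientAddGroup.mk_surjective c
    exact ⟨⟨CocycleCat l⟩, nonempty_iso_cocycleCat l⟩

lemma subsingleton_homClasses [classifying.{v, u}.Faithful] {G G' : GrCat.{v, u}}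
    (p : classifying.obj G ⟶ classifying.obj G') : Subsingleton (HomClasses classifying p) := by
  refine ⟨?_⟩
  rintro ⟨F⟩ ⟨K⟩
  have h : F = K := Subtype.ext (classifying.map_injective (F.2.trans K.2.symm))
  rw [h]

lemma not_faithful_classifying : ¬ (classifying.{v, u}).Faithful := by
  intro hfaithful
  let G := classifying.{v, u}.objPreimage H3Gr.orderTwo
  obtain ⟨z, hz, hz'⟩ :=
    H3Gr.exists_cocycle_ne_d1 (classifying.{v, u}.objObjPreimageIso H3Gr.orderTwo)
  -- If the functor were faithful, the identity would have one homotopy class above it, so `H²`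
  -- would vanish; but `z` is a cocycle that is not a coboundary.
  have := subsingleton_homClasses (𝟙 (classifying.obj G))
  obtain ⟨e⟩ := nonempty_homClasses_equiv (𝟙 (classifying.obj G))
  have := e.symm.subsingleton
  obtain ⟨t, ht⟩ := QuotientAddGroup.eq.mp (Subsingleton.elim
    (0 : H2 ((classifying.obj G).action.comp (H3Gr.Hom.φ (𝟙 (classifying.obj G)))))
    (QuotientAddGroup.mk ⟨z, hz⟩))
  refine hz' t (Eq.trans ht ?_)
  change -0 + z = z
  rw [neg_zero, zero_add]

end GrCat

/-- The data `h` and `m` are quantified separately from `d` so that the values of `d` can be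
prescribed by one equality of prefunctors. -/
theorem theorem3p1 :
    ∃ (h : (G : GrCat.{v, u}) → H3 (pi1Action G.carrier))
      (m : (G G' : GrCat.{v, u}) → (G ⟶ G') →
        (H3Gr.mk (Pi0 G.carrier) (Pi1 G.carrier) (pi1Action G.carrier) (h G) ⟶
          H3Gr.mk (Pi0 G'.carrier) (Pi1 G'.carrier) (pi1Action G'.carrier) (h G')))
      (d : GrCat.{v, u} ⥤ H3Gr.{v, u}),
      (∀ (G : GrCat.{v, u}) (S : Stick G.carrier),
        ∃ hS : S.assocCochain ∈ Z3 (pi1Action G.carrier),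
          h G = H3.mk (pi1Action G.carrier) ⟨S.assocCochain, hS⟩) ∧
      (∀ (G G' : GrCat.{v, u}) (F : G ⟶ G'),
        (m G G' F).φ = GrCat.pi0Map F ∧ (m G G' F).f = GrCat.pi1Map F) ∧
      d.toPrefunctor =
        { obj := fun G => H3Gr.mk (Pi0 G.carrier) (Pi1 G.carrier) (pi1Action G.carrier) (h G)
          map := fun {G G'} F => m G G' F } ∧
      (∀ (G G' : GrCat.{v, u}) (F : G ⟶ G'),
        (IsIso (d.map F) ↔ F.functor.IsEquivalence) ∧
        (IsIso (d.map F) ↔ GrCat.IsMonoidalEquivalence F)) ∧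
      d.EssSurj ∧
      d.Full ∧
      ¬ d.Faithful ∧
      (∀ (G G' : GrCat.{v, u}) (p : d.obj G ⟶ d.obj G'),
        Nonempty (GrCat.HomClasses d p ≃ H2 ((d.obj G').action.comp p.φ))) := by
  refine ⟨GrCat.assocClass, fun _ _ F => GrCat.invariantsMap F, GrCat.classifying,
    fun _ S => ⟨GrCat.assocCochain_mem_Z3 S, GrCat.assocClass_eq S⟩, fun _ _ _ => ⟨rfl, rfl⟩, rfl,
    fun _ _ F => ?_, inferInstance, inferInstance, GrCat.not_faithful_classifying,
    fun _ _ p => GrCat.nonempty_homClasses_equiv p⟩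
  -- Cycle: isomorphism of invariants, equivalence of categories, monoidal equivalence, isomorphism
  -- of invariants.
  have h₁ (_ : IsIso (GrCat.classifying.map F)) := GrCat.isEquivalence_of_isIso_map F
  have h₂ := GrCat.isMonoidalEquivalence_of_isEquivalence F
  have h₃ := GrCat.isIso_map_of_isMonoidalEquivalence (F := F)
  exact ⟨⟨h₁, fun h => h₃ (h₂ h)⟩, ⟨fun h => h₂ (h₁ h), h₃⟩⟩
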